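/- **Setting.** Let $\mathcal X\subset\mathbb R^D$ (Euclidean norm) and let $\mathbf X=(X_1,\dots,X_n)$, $n\ge 1$, be a fixed sample of points of $\mathcal X$ with empirical measure $\mu_n$. The Assouad dimension of $\mathcal X$ is the smallest real $d$ such that for every ball $B\subset\mathbb R^D$ the set $B\cap\mathcal X$ can be covered by at most $2^d$ balls of half the radius of $B$. For $A\subset\mathbb R^D$ let $\Delta_n(A)=\max_{x,x'\in A\cap\mathbf X}\|x-x'\|$ ($0$ if $A\cap\mathbf X=\emptyset$), and for a finite collection $\mathbf A$ of disjoint cells let $\Delta_n(\mathbf A)=\big(\sum_{A\in\mathbf A}\mu_n(A)\Delta_n^2(A)\big/\sum_{A\in\mathbf A}\mu_n(A)\big)^{1/2}$ ($0$ if $\mathbf A$ contains no data). Let $\log=\log_2$, let $\delta\in(0,1)$, and put $\alpha(n)=(\log^2 n)\log\log(n/\delta)+\log(1/\delta)$. Medians are the average of the two middle values, sample points being counted with multiplicity. * **basicRPtree**$(A_0,\Delta,l)$: start with $\mathbf A_0=\{A_0\}$. In round $i=1,2,\dots$: if $\Delta_n(\mathbf A_{i-1})\le\Delta$, return the current tree;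 otherwise draw a direction $v\sim\mathcal N(0,\frac1D I_D)$ and $\tau\sim\mathcal U[-1,1]\cdot\frac{6}{\sqrt D}\Delta_n(A_0)$, and split every cell $A\in\mathbf A_{i-1}$ into $\{x\in A: x^\top v\le t\}$ and its complement in $A$, where $t=\mathrm{median}\{z^\top v: z\in\mathbf X\cap A_0\}+\tau$ if $l+i$ is odd and $t=\mathrm{median}\{z^\top v: z\in\mathbf X\cap A\}$ otherwise; $\mathbf A_i$ is the resulting partition of $A_0$. * **coreRPtree**$(A_0,\Delta,\delta,l)$: call basicRPtree$(A_0,\Delta,l)$ independently $\lceil\log(6n^2/\delta)\rceil$ times and return the shortest tree. * **adaptiveRPtree**: start with the root $\mathbf A^0=\{\mathcal X\}$ at level $0$. In pass $i=1,2,\dots$, grow at every cell $A\in\mathbf A^{i-1}$ (at level $l$ of the tree) the subtree returned by coreRPtree$(A,\Delta_n(A)/2,\delta,l)$. Let $\mathbf A^i$ be the partition given by the leaves of the current tree, and $\mathrm{level}(\mathbf A^i)$ the largest level of one of its cells. Stop growing the tree if the criterion of the chosen option holds. Cross-validation: $\Delta_n(\mathbf A^i)=0$ or $\mathrm{level}(\mathbf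 A^i)\ge\log n^2$. Automatic stopping: $\Delta_n(\mathbf A^i)=0$ or $\mathrm{level}(\mathbf A^i)\ge\log\frac{n\,\Delta_n^2(\mathbf A^i)}{\alpha(n)\,\Delta_n^2(\mathcal X)}$. All random draws are independent. The algorithm *attains a diameter decrease rate of $k$* on $\mathbf X$, where $k\ge d$, if every call coreRPtree$(A,\Delta_n(A)/2,\delta,l)$ that adaptiveRPtree makes returns a tree rooted at $A$ of depth at most $k$. **Statement.** There is an absolute constant $C'>0$ (independent of $D$, $\mathcal X$, $d$, $n$, $\mathbf X$, $\delta$ and the stopping option) such that: if $\mathcal X\subset\mathbb R^D$ has Assouad dimension $d>1$ and the sample $\mathbf X$ of $n\ge1$ points of $\mathcal X$ is fixed, then for every $\delta\in(0,1)$ and for either stopping option, with probability at least $1-\delta/3$ over the randomness in the algorithm, adaptiveRPtree attains a diameter decrease rate of some $k\le C'd\log d$ on $\mathbf X$. -/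

import Mathlib

open MeasureTheory ProbabilityTheory

noncomputable section

namespace RPTree

/-- `ℝ^D` with the Euclidean norm. -/
abbrev Space (D : ℕ) := EuclideanSpace ℝ (Fin D)

/-- `S ⊆ ℝ^D` has Assouad dimension `d`: `d` is the smallest real number such that, for every ball
`B` of `ℝ^D`, the set `B ∩ S` can be covered by (at most) `2^d` balls of half the radius. -/
def IsAssouadDim {D : ℕ} (S : Set (Space D)) (d : ℝ) : Prop :=
  IsLeast {s : ℝ | ∀ (x : Space D) (r : ℝ), 0 < r →
    ∃ T : Finset (Space D), (T.card : ℝ) ≤ (2 : ℝ) ^ s ∧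
      Metric.closedBall x r ∩ S ⊆ ⋃ y ∈ T, Metric.closedBall y (r / 2)} d

/-! ### Data diameters and medians -/

/-- Data diameter `Δ_n(A)`: the largest distance between two sample points lying in `A`
(`0` if there are none). The set is finite, so `Metric.diam` is a maximum. -/
def dataDiam {D n : ℕ} (X : Fin n → Space D) (A : Set (Space D)) : ℝ :=
  Metric.diam (A ∩ Set.range X)

/-- Empirical measure `μ_n(A)`. -/
def empMass {D n : ℕ} (X : Fin n → Space D) (A : Set (Space D)) : ℝ :=
  (Nat.card {i : Fin n // X i ∈ A} : ℝ) / n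

/-- The average of the two middle elements of the sorted list (for an odd number of elements both
are the middle one); `0` for the empty multiset. -/
def median (s : Multiset ℝ) : ℝ :=
  ((s.sort (· ≤ ·)).getD ((s.card - 1) / 2) 0 + (s.sort (· ≤ ·)).getD (s.card / 2) 0) / 2

open Classical in
/-- `median {zᵀ v : z ∈ 𝐗 ∩ A}`, where sample points are counted with multiplicity. -/
def projMedian {D n : ℕ} (X : Fin n → Space D) (A : Set (Space D)) (v : Space D) : ℝ :=
  median ((Finset.univ.filter fun i => X i ∈ A).val.map fun i => inner ℝ (X i) v)

/-! ### Nodes of the tree and partitions -/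

/-- A node of the binary tree: its address (the list of left / right turns that lead to it from the
root, most recent turn first; `false` is left and `true` is right) and its cell. -/
structure Node (D : ℕ) where
  addr : List Bool
  cell : Set (Space D)

/-- The level of a node; the root has level `0`. -/
def Node.level {D : ℕ} (N : Node D) : ℕ := N.addr.length

/-- The two children: `A_left = {x ∈ A : xᵀ v ≤ t}` and `A_right = A \ A_left`. -/
def Node.split {D : ℕ} (N : Node D) (v : Space D) (t : ℝ) : List (Node D) :=
  [⟨false :: N.addr, {x ∈ N.cell | inner ℝ x v ≤ t}⟩,
   ⟨true :: N.addr, N.cell \ {x ∈ N.cell | inner ℝ x v ≤ t}⟩]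

/-- Average data diameter `Δ_n(𝐀) = (∑ μ_n(A) Δ_n(A)² / ∑ μ_n(A))^{1/2}` of a collection of cells
(`0` if the collection contains no data). -/
def avgDiam {D n : ℕ} (X : Fin n → Space D) (P : List (Node D)) : ℝ :=
  Real.sqrt ((P.map fun N => empMass X N.cell * dataDiam X N.cell ^ 2).sum /
    (P.map fun N => empMass X N.cell).sum)

/-- The level of a partition: the largest level of one of its cells. -/
def maxLevel {D : ℕ} (P : List (Node D)) : ℕ := (P.map Node.level).foldr max 0

/-! ### basicRPtree and coreRPtree -/

/-- A call returns a tree, recorded by its depth and its leaves. -/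
structure Subtree (D : ℕ) where
  depth : ℕ∞
  leaves : List (Node D)

/-- The threshold at which `basicRPtree`, called on `A₀` at level `l`, splits the cell `A` in its
round `i`; the noise is `τ = u · 6 Δ_n(A₀) / √D` with `u ∈ [-1, 1]`. -/
def threshold {D n : ℕ} (X : Fin n → Space D) (A₀ A : Set (Space D)) (l i : ℕ)
    (v : Space D) (u : ℝ) : ℝ :=
  if Odd (l + i) then projMedian X A₀ v + u * (6 / Real.sqrt D * dataDiam X A₀)
  else projMedian X A v

/-- The partition `𝐀_i` of the cell of `N₀` after `i` rounds of `basicRPtree`; `w i` is the pair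
`(v, u)` drawn in round `i + 1`, which is shared by all the cells split in that round. -/
def basicPartition {D n : ℕ} (X : Fin n → Space D) (N₀ : Node D) (l : ℕ)
    (w : ℕ → Space D × ℝ) : ℕ → List (Node D)
  | 0 => [N₀]
  | i + 1 => (basicPartition X N₀ l w i).flatMap fun N =>
      N.split (w i).1 (threshold X N₀.cell N.cell l (i + 1) (w i).1 (w i).2)

/-- The number of rounds executed by `basicRPtree(N₀, Δ, l)`, i.e. the first `i` such that
`Δ_n(𝐀_i) ≤ Δ` (`⊤` if there is none: the procedure does not halt). Each round splits every leaf,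
so this is the depth of the tree it returns. -/
def basicDepth {D n : ℕ} (X : Fin n → Space D) (N₀ : Node D) (Δ : ℝ) (l : ℕ)
    (w : ℕ → Space D × ℝ) : ℕ∞ :=
  sInf ((fun i : ℕ => (i : ℕ∞)) '' {i : ℕ | avgDiam X (basicPartition X N₀ l w i) ≤ Δ})

/-- `basicRPtree(N₀, Δ, l)` run on the draws `w`. -/
def basicRPtree {D n : ℕ} (X : Fin n → Space D) (N₀ : Node D) (Δ : ℝ) (l : ℕ)
    (w : ℕ → Space D × ℝ) : Subtree D where
  depth := basicDepth X N₀ Δ l w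
  leaves := basicPartition X N₀ l w (basicDepth X N₀ Δ l w).toNat

/-- The number `log₂ (6 n² / δ)`, rounded up, of runs of `basicRPtree` in a call of
`coreRPtree`. -/
def numRuns (n : ℕ) (δ : ℝ) : ℕ := ⌈Real.logb 2 (6 * (n : ℝ) ^ 2 / δ)⌉₊

/-- `coreRPtree(N, Δ, δ, l)`: run `basicRPtree` `numRuns n δ` times and return the (first) shortest
tree. `w j i` is the pair drawn in round `i + 1` of run `j`. -/
def coreRPtree {D n : ℕ} (X : Fin n → Space D) (N : Node D) (Δ δ : ℝ) (l : ℕ)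
    (w : ℕ → ℕ → Space D × ℝ) : Subtree D :=
  (((List.range (numRuns n δ)).map fun j => basicRPtree X N Δ l (w j)).argmin
    Subtree.depth).getD (basicRPtree X N Δ l (w 0))

/-! ### Randomness -/

/-- The random draws of the algorithm: `ω (a, j, i) = (v, u)` is the pair drawn in round `i + 1` of
run `j` of `basicRPtree` when `coreRPtree` grows the node of address `a`. One block of draws per
node is enough: if a node is the root of more than one call, then every call but the last has
returned the node itself (a tree of depth `0`), for which no pair is drawn. -/
abbrev Tape (D : ℕ) := List Bool × ℕ × ℕ → Space D × ℝ

/-- Law of one draw `(v, u)`: `v ∼ N(0, I_D / D)` and, independently, `u ∼ U[-1, 1]`. -/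
def drawLaw (D : ℕ) : Measure (Space D × ℝ) :=
  ((stdGaussian (Space D)).map fun z => (Real.sqrt D)⁻¹ • z).prod
    (ProbabilityTheory.cond volume (Set.Icc (-1 : ℝ) 1))

instance isProbabilityMeasure_drawLaw (D : ℕ) : IsProbabilityMeasure (drawLaw D) := by
  have h1 : IsProbabilityMeasure
      ((stdGaussian (Space D)).map fun z => (Real.sqrt D)⁻¹ • z) :=
    Measure.isProbabilityMeasure_map (by fun_prop)
  have h2 : IsProbabilityMeasure (ProbabilityTheory.cond volume (Set.Icc (-1 : ℝ) 1)) :=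
    cond_isProbabilityMeasure_of_finite (by simp) (by simp)
  unfold drawLaw
  infer_instance

/-- All the draws are independent. -/
def tapeLaw (D : ℕ) : Measure (Tape D) := Measure.infinitePi fun _ => drawLaw D

/-! ### adaptiveRPtree -/

/-- The two stopping options. -/
inductive StopOption
  | crossValidation
  | automatic

/-- `α(n) = (log² n) log log (n / δ) + log (1 / δ)`, logarithms in base `2`. -/
def alpha (n : ℕ) (δ : ℝ) : ℝ :=
  Real.logb 2 n ^ 2 * Real.logb 2 (Real.logb 2 (n / δ)) + Real.logb 2 (1 / δ)

/-- The stopping criterion, evaluated at the partition `P`. For both options it holds when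
`Δ_n(P) = 0` (for automatic stopping: `log 0 = -∞`). -/
def Stops {D n : ℕ} (opt : StopOption) (X : Fin n → Space D) (S : Set (Space D)) (δ : ℝ)
    (P : List (Node D)) : Prop :=
  match opt with
  | .crossValidation => avgDiam X P = 0 ∨ Real.logb 2 ((n : ℝ) ^ 2) ≤ maxLevel P
  | .automatic => avgDiam X P = 0 ∨
      Real.logb 2 (n * avgDiam X P ^ 2 / (alpha n δ * dataDiam X S ^ 2)) ≤ maxLevel P

/-- The call of `coreRPtree` made by `adaptiveRPtree` at the node `N`. -/
def coreCall {D n : ℕ} (X : Fin n → Space D) (δ : ℝ) (ω : Tape D) (N : Node D) : Subtree D :=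
  coreRPtree X N (dataDiam X N.cell / 2) δ N.level fun j i => ω (N.addr, j, i)

/-- The partition `𝐀^i` of `S` built by `adaptiveRPtree` after `i` passes of its main loop. -/
def adaptivePartition {D n : ℕ} (X : Fin n → Space D) (S : Set (Space D)) (δ : ℝ)
    (ω : Tape D) : ℕ → List (Node D)
  | 0 => [⟨[], S⟩]
  | i + 1 => (adaptivePartition X S δ ω i).flatMap fun N => (coreCall X δ ω N).leaves

/-- Pass `i + 1` of the main loop is executed: the stopping criterion, which is evaluated at the end
of each pass, has held at none of the passes `1, …, i`. -/
def PassExecuted {D n : ℕ} (opt : StopOption) (X : Fin n → Space D) (S : Set (Space D)) (δ : ℝ)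
    (ω : Tape D) (i : ℕ) : Prop :=
  ∀ j, 1 ≤ j → j ≤ i → ¬ Stops opt X S δ (adaptivePartition X S δ ω j)

/-- Run on the draws `ω`, `adaptiveRPtree` attains a diameter decrease rate of `k` on the sample
`X`, `k ≥ d`: every call `coreRPtree(A, Δ_n(A)/2, δ, l)` that it makes, i.e. one for each cell `A`
of `𝐀^i` in each executed pass `i + 1`, halts and returns a tree of depth at most `k`. -/
def AttainsRate {D n : ℕ} (opt : StopOption) (X : Fin n → Space D) (S : Set (Space D)) (δ d : ℝ)
    (ω : Tape D) (k : ℝ) : Prop :=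
  d ≤ k ∧ ∀ i, PassExecuted opt X S δ ω i → ∀ N ∈ adaptivePartition X S δ ω i,
    ∃ m : ℕ, (coreCall X δ ω N).depth = m ∧ (m : ℝ) ≤ k

end RPTree

end

/-!
In a round with a noisy split, `basicRPtree` cuts all cells by one common hyperplane, placed at the
median of the root cell `A` plus a uniform offset of order `Δ / √D`, where `Δ` is the data diameter
of `A`. Hence points that lie on different sides of one of these hyperplanes end up in different
cells, whatever the remaining splits do, and it suffices to separate, with the noisy hyperplanes of
`O(d log d)` rounds, all pairs of sample points of `A` at distance more than `Δ / 2`: then every cell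
has data diameter at most `Δ / 2` and the run stops.

Cover the data of `A` by `2 ^ O(d log d)` balls of radius about `Δ / (4096 d)`. Chaining over finer and
finer nets (`HasDoublingConst.exists_projection_bound`) shows that a random direction shrinks each
ball to a projected radius that is a small multiple of `Δ / √D`. With constant probability the
projections of two distant balls are also `Δ / (8 √D)` apart (Gaussian anti-concentration) while the
median is within `3 Δ / √D` of them (Chebyshev), so that the offset falls between them with constant
probability: `exists_separating_event`. A union bound over pairs of balls makes a single run fail
with probability at most `1 / 2`, and a call with its `⌈log (6 n² / δ)⌉` independent runs with
probability at most `δ / (6 n²)`: `exists_call_event`.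

The calls that are made depend on the earlier draws. However, the event that a given node is reached
depends on the draws at other nodes only, so it is independent of the failure of the call at that
node, and the probability that some call fails is at most `δ / (6 n²)` times the expected number of
calls at cells with data: `tapeLaw_iUnion_reached_inter_le`. This number is at most `2 n`, since a
call that halts with a tree of positive depth splits the data of its cell into at least two
nonempty parts: `exists_split_codes`. The count does not refer to a stopping
criterion, and so it covers both options. To make all this measurable, the algorithm is followed on the
countable type of codes of nodes, which keep only the indices of the sample points in a cell.

Finally, `2 ^ d` is an integer, as it is an optimal number of balls, so `1 < d` forces
`d ≥ log 3`, and `O(d log d)` absorbs additive constants: `exists_parameters`.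
-/

noncomputable section

namespace RPTree

/-! ### One-dimensional marginals of the random direction -/

/-- The law `N(0, I_D / D)` of the random direction. -/
def dirLaw (D : ℕ) : Measure (Space D) :=
  (stdGaussian (Space D)).map fun z => (Real.sqrt D)⁻¹ • z

/-- The law `U[-1, 1]` of the random offset. -/
def offsetLaw : Measure ℝ := ProbabilityTheory.cond volume (Set.Icc (-1 : ℝ) 1)

instance isProbabilityMeasure_dirLaw (D : ℕ) : IsProbabilityMeasure (dirLaw D) :=
  Measure.isProbabilityMeasure_map (by fun_prop)

instance isProbabilityMeasure_offsetLaw : IsProbabilityMeasure offsetLaw :=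
  cond_isProbabilityMeasure_of_finite (by simp) (by simp)

lemma drawLaw_eq_prod (D : ℕ) : drawLaw D = (dirLaw D).prod offsetLaw := rfl

lemma gaussianReal_sq_eq_map (s : ℝ) :
    gaussianReal 0 (s ^ 2).toNNReal = (gaussianReal 0 1).map fun g => s * g := by
  rw [gaussianReal_map_const_mul]
  congr 1
  · simp
  · ext; simp [sq_nonneg]

/-- The projection of the random direction on `z` is distributed as `‖z‖ / √D` times a standard
Gaussian variable. -/
lemma map_inner_dirLaw {D : ℕ} (z : Space D) :
    (dirLaw D).map (fun v => inner ℝ z v) =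
      (gaussianReal 0 1).map fun g => ‖z‖ / Real.sqrt D * g := by
  rw [← gaussianReal_sq_eq_map, dirLaw, Measure.map_map (by fun_prop) (by fun_prop)]
  have h : (fun v => inner ℝ z v) ∘ (fun v : Space D => (Real.sqrt D)⁻¹ • v) =
      innerSL ℝ ((Real.sqrt D)⁻¹ • z) := by
    ext v; simp [inner_smul_right]
  rw [h, IsGaussian.map_eq_gaussianReal, integral_strongDual_stdGaussian, variance_dual_stdGaussian,
    innerSL_apply_norm, norm_smul]
  congr 3
  rw [Real.norm_of_nonneg (by positivity)]
  ring

lemma dirLaw_inner_preimage {D : ℕ} (z : Space D) {s : Set ℝ} (hs : MeasurableSet s) :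
    dirLaw D {v | inner ℝ z v ∈ s} = gaussianReal 0 1 {g | ‖z‖ / Real.sqrt D * g ∈ s} := by
  have h := congrArg (fun μ => μ s) (map_inner_dirLaw z)
  rwa [Measure.map_apply (by fun_prop) hs, Measure.map_apply (by fun_prop) hs] at h

lemma gaussianReal_abs_gt_le (t : ℝ) :
    gaussianReal 0 1 {g | t < |g|} ≤ ENNReal.ofReal (4 * Real.exp (-t)) := by
  have hexp : Real.exp (1 / 2) ≤ 2 := by
    have h := Real.exp_one_lt_d9
    have h2 : Real.exp (1 / 2) ^ 2 = Real.exp 1 := by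
      rw [← Real.exp_nat_mul]; norm_num
    nlinarith [Real.exp_pos (1 / 2)]
  have key : ∀ σ : ℝ, σ ^ 2 = 1 → (gaussianReal 0 1).real {g | t ≤ σ * g} ≤
      2 * Real.exp (-t) := by
    intro σ hσ
    have hmap : (gaussianReal 0 1).map (fun g => σ * g) = gaussianReal 0 1 := by
      rw [gaussianReal_map_const_mul]
      congr 1
      · simp
      · ext; simp [hσ]
    have h := measure_ge_le_exp_mul_mgf (X := fun g : ℝ => σ * g) (μ := gaussianReal 0 1) t
      (zero_le_one' ℝ) (by
        have := integrable_exp_mul_gaussianReal (μ := 0) (v := 1) σ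
        simpa using this)
    rw [mgf_gaussianReal hmap] at h
    refine h.trans ?_
    simp only [NNReal.coe_one]
    norm_num
    nlinarith [Real.exp_pos (-t)]
  have hsub : {g : ℝ | t < |g|} ⊆ {g | t ≤ 1 * g} ∪ {g | t ≤ -1 * g} := by
    intro g hg
    rcases lt_abs.1 (show t < |g| from hg) with h | h
    · left; simp; linarith
    · right; simp; linarith
  have h3 : (gaussianReal 0 1).real {g | t < |g|} ≤ 4 * Real.exp (-t) := by
    refine (measureReal_mono hsub).trans ((measureReal_union_le _ _).trans ?_)
    have h1 := key 1 (by norm_num)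
    have h2 := key (-1) (by norm_num)
    linarith
  rw [← ofReal_measureReal]
  exact ENNReal.ofReal_le_ofReal h3

lemma gaussianReal_abs_lt_le (c : ℝ) :
    gaussianReal 0 1 {g | |g| < c} ≤ ENNReal.ofReal c := by
  rw [gaussianReal_apply 0 (by simp)]
  have hpdf : ∀ x, gaussianPDF 0 1 x ≤ ENNReal.ofReal (1 / 2) := by
    intro x
    apply ENNReal.ofReal_le_ofReal
    rw [gaussianPDFReal]
    have h1 : (2 : ℝ) ≤ Real.sqrt (2 * Real.pi * (1 : NNReal)) := by
      apply Real.le_sqrt_of_sq_le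
      have := Real.pi_gt_three
      simp; linarith
    have h2 : Real.exp (-(x - 0) ^ 2 / (2 * (1 : NNReal))) ≤ 1 := by
      apply Real.exp_le_one_iff.2
      have := sq_nonneg x
      simp; linarith
    have h3 : (Real.sqrt (2 * Real.pi * (1 : NNReal)))⁻¹ ≤ 1 / 2 := by
      rw [one_div]; exact inv_anti₀ (by norm_num) h1
    calc _ ≤ (1 / 2 : ℝ) * 1 := by gcongr
      _ = _ := by norm_num
  calc _ ≤ ∫⁻ _ in {g : ℝ | |g| < c}, ENNReal.ofReal (1 / 2) := by gcongr; exact hpdf _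
    _ = ENNReal.ofReal (1 / 2) * volume {g : ℝ | |g| < c} := by simp
    _ = _ := by
      have : {g : ℝ | |g| < c} = Set.Ioo (-c) c := by ext g; simp [abs_lt]
      rw [this, Real.volume_Ioo, ← ENNReal.ofReal_mul (by norm_num)]
      congr 1; ring

lemma lintegral_sq_gaussianReal :
    ∫⁻ g, ENNReal.ofReal (g ^ 2) ∂(gaussianReal 0 1) = 1 := by
  have h := variance_id_gaussianReal (μ := 0) (v := 1)
  rw [variance_of_integral_eq_zero (by fun_prop) (by simp)] at h
  have hi : Integrable (fun g : ℝ => g ^ 2) (gaussianReal 0 1) :=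
    (memLp_id_gaussianReal 2).integrable_sq
  rw [← ofReal_integral_eq_lintegral_ofReal hi (ae_of_all _ fun g => sq_nonneg g)]
  simp only [id] at h
  simp [h]

/-- Exponential tail of a projection. -/
lemma dirLaw_inner_gt_le {D : ℕ} (z : Space D) (t : ℝ) :
    dirLaw D {v | t * (‖z‖ / Real.sqrt D) < |inner ℝ z v|} ≤
      ENNReal.ofReal (4 * Real.exp (-t)) := by
  have hm : MeasurableSet {x : ℝ | t * (‖z‖ / Real.sqrt D) < |x|} :=
    measurableSet_lt (by fun_prop) (by fun_prop)
  refine (dirLaw_inner_preimage z hm).trans_le ((measure_mono ?_).trans (gaussianReal_abs_gt_le t))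
  intro g hg
  have h0 : 0 ≤ ‖z‖ / Real.sqrt D := by positivity
  simp only [Set.mem_ofPred_eq, abs_mul, abs_of_nonneg h0] at hg ⊢
  by_contra hcon
  nlinarith

/-- Anti-concentration of a projection. -/
lemma dirLaw_inner_lt_le {D : ℕ} (z : Space D) (c : ℝ) :
    dirLaw D {v | |inner ℝ z v| < c * (‖z‖ / Real.sqrt D)} ≤ ENNReal.ofReal c := by
  have hm : MeasurableSet {x : ℝ | |x| < c * (‖z‖ / Real.sqrt D)} :=
    measurableSet_lt (by fun_prop) (by fun_prop)
  refine (dirLaw_inner_preimage z hm).trans_le ((measure_mono ?_).trans (gaussianReal_abs_lt_le c))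
  intro g hg
  have h0 : 0 ≤ ‖z‖ / Real.sqrt D := by positivity
  simp only [Set.mem_ofPred_eq, abs_mul, abs_of_nonneg h0] at hg ⊢
  by_contra hcon
  nlinarith

lemma lintegral_inner_sq_dirLaw {D : ℕ} (z : Space D) :
    ∫⁻ v, ENNReal.ofReal (inner ℝ z v ^ 2) ∂(dirLaw D) =
      ENNReal.ofReal ((‖z‖ / Real.sqrt D) ^ 2) := by
  have h := congrArg (fun μ => ∫⁻ x, ENNReal.ofReal (x ^ 2) ∂μ) (map_inner_dirLaw z)
  rw [lintegral_map (by fun_prop) (by fun_prop), lintegral_map (by fun_prop) (by fun_prop)] at h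
  rw [h]
  simp_rw [mul_pow, ENNReal.ofReal_mul (sq_nonneg (‖z‖ / Real.sqrt D))]
  rw [lintegral_const_mul _ (by fun_prop), lintegral_sq_gaussianReal, mul_one]

/-! ### Covering numbers and chaining -/

/-- Every ball intersected with `S` is covered by `M` balls of half the radius. -/
def HasDoublingConst {D : ℕ} (S : Set (Space D)) (M : ℕ) : Prop :=
  ∀ (x : Space D) (r : ℝ), 0 < r → ∃ T : Finset (Space D), T.card ≤ M ∧
    Metric.closedBall x r ∩ S ⊆ ⋃ y ∈ T, Metric.closedBall y (r / 2)

/-- Since covers have an integral number of balls, `2 ^ d` is an integer for the smallest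
exponent `d`; hence `1 < d` forces `3 ≤ 2 ^ d`, which keeps `log d` away from `0`. -/
lemma IsAssouadDim.exists_hasDoublingConst {D : ℕ} {S : Set (Space D)} {d : ℝ}
    (h : IsAssouadDim S d) (hd : 1 < d) :
    ∃ M : ℕ, 3 ≤ M ∧ (M : ℝ) = (2 : ℝ) ^ d ∧ HasDoublingConst S M := by
  have hpow : (2 : ℝ) < (2 : ℝ) ^ d := by
    simpa using Real.rpow_lt_rpow_of_exponent_lt (x := 2) (by norm_num) hd
  have hM2 : 2 ≤ ⌊(2 : ℝ) ^ d⌋₊ := Nat.le_floor (by exact_mod_cast hpow.le)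
  have hle : (⌊(2 : ℝ) ^ d⌋₊ : ℝ) ≤ (2 : ℝ) ^ d := Nat.floor_le (by positivity)
  have hcov : HasDoublingConst S ⌊(2 : ℝ) ^ d⌋₊ := by
    intro x r hr
    obtain ⟨T, hT, hc⟩ := h.1 x r hr
    exact ⟨T, Nat.le_floor hT, hc⟩
  have hMpos : (0 : ℝ) < (⌊(2 : ℝ) ^ d⌋₊ : ℝ) := by
    have : 0 < ⌊(2 : ℝ) ^ d⌋₊ := by omega
    exact_mod_cast this
  have hlog : (2 : ℝ) ^ (Real.logb 2 (⌊(2 : ℝ) ^ d⌋₊ : ℝ)) = (⌊(2 : ℝ) ^ d⌋₊ : ℝ) :=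
    Real.rpow_logb (by norm_num) (by norm_num) hMpos
  have hge : d ≤ Real.logb 2 (⌊(2 : ℝ) ^ d⌋₊ : ℝ) := by
    apply h.2
    intro x r hr
    obtain ⟨T, hT, hc⟩ := hcov x r hr
    refine ⟨T, ?_, hc⟩
    rw [hlog]
    exact_mod_cast hT
  have heq : (⌊(2 : ℝ) ^ d⌋₊ : ℝ) = (2 : ℝ) ^ d := by
    refine le_antisymm hle ?_
    rw [← hlog]
    exact Real.rpow_le_rpow_of_exponent_le (by norm_num) hge
  refine ⟨_, ?_, heq, hcov⟩
  have : (2 : ℝ) < (⌊(2 : ℝ) ^ d⌋₊ : ℝ) := by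
    rw [heq]; exact hpow
  have : 2 < ⌊(2 : ℝ) ^ d⌋₊ := by exact_mod_cast this
  omega

open Classical in
/-- A set of at most `M` centres of balls of radius `r / 2` that cover `S` near `x`. -/
def HasDoublingConst.centers {D M : ℕ} {S : Set (Space D)} (h : HasDoublingConst S M)
    (x : Space D) (r : ℝ) : Finset (Space D) :=
  if hr : 0 < r then (h x r hr).choose else ∅

lemma HasDoublingConst.card_centers_le {D M : ℕ} {S : Set (Space D)} (h : HasDoublingConst S M)
    (x : Space D) (r : ℝ) : (h.centers x r).card ≤ M := by
  unfold HasDoublingConst.centers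
  split_ifs with hr
  · exact (h x r hr).choose_spec.1
  · simp

lemma HasDoublingConst.exists_mem_centers {D M : ℕ} {S : Set (Space D)} (h : HasDoublingConst S M)
    {x z : Space D} {r : ℝ} (hr : 0 < r) (hz : z ∈ S) (hzx : ‖z - x‖ ≤ r) :
    ∃ c ∈ h.centers x r, ‖z - c‖ ≤ r / 2 := by
  have hz' := (h x r hr).choose_spec.2 ⟨by simpa [dist_eq_norm] using hzx, hz⟩
  simp only [Set.mem_iUnion, Metric.mem_closedBall, dist_eq_norm, exists_prop] at hz'
  obtain ⟨c, hc, hzc⟩ := hz'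
  refine ⟨c, ?_, hzc⟩
  unfold HasDoublingConst.centers
  rwa [dif_pos hr]

open Classical in
/-- The centres of the cover of `S ∩ B(y, r)` by balls of radius `r / 2 ^ k` that results from
`k` successive refinements. -/
def HasDoublingConst.net {D M : ℕ} {S : Set (Space D)} (h : HasDoublingConst S M)
    (y : Space D) (r : ℝ) : ℕ → Finset (Space D)
  | 0 => {y}
  | k + 1 => (h.net y r k).biUnion fun c => h.centers c (r / 2 ^ k)

lemma HasDoublingConst.card_net_le {D M : ℕ} {S : Set (Space D)} (h : HasDoublingConst S M)
    (y : Space D) (r : ℝ) (k : ℕ) : (h.net y r k).card ≤ M ^ k := by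
  classical
  induction k with
  | zero => simp [HasDoublingConst.net]
  | succ k ih =>
    rw [HasDoublingConst.net, pow_succ]
    refine (Finset.card_biUnion_le_card_mul _ _ M fun c _ => h.card_centers_le _ _).trans ?_
    exact Nat.mul_le_mul_right _ ih

lemma HasDoublingConst.exists_mem_net {D M : ℕ} {S : Set (Space D)} (h : HasDoublingConst S M)
    {y z : Space D} {r : ℝ} (hr : 0 < r) (hz : z ∈ S) (hzy : ‖z - y‖ ≤ r) (k : ℕ) :
    ∃ c ∈ h.net y r k, ‖z - c‖ ≤ r / 2 ^ k := by
  classical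
  induction k with
  | zero => exact ⟨y, by simp [HasDoublingConst.net], by simpa using hzy⟩
  | succ k ih =>
    obtain ⟨c, hc, hzc⟩ := ih
    obtain ⟨c', hc', hzc'⟩ := h.exists_mem_centers (by positivity) hz hzc
    refine ⟨c', Finset.mem_biUnion.2 ⟨c, hc, hc'⟩, hzc'.trans_eq ?_⟩
    rw [pow_succ]; field_simp

lemma sum_succ_div_two_pow_le (K : ℕ) :
    ∑ k ∈ Finset.range K, ((k : ℝ) + 1) / 2 ^ k ≤ 4 := by
  have h : ∑ k ∈ Finset.range K, ((k : ℝ) + 1) / 2 ^ k = 4 - (2 * K + 4) / 2 ^ K := by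
    induction K with
    | zero => norm_num
    | succ K ih =>
      rw [Finset.sum_range_succ, ih, pow_succ]
      push_cast
      field_simp
      ring
  rw [h]
  have : (0 : ℝ) ≤ (2 * K + 4) / 2 ^ K := by positivity
  linarith

/-- The tail at threshold `6 d` beats the branching number `2 ^ d` of the nets. -/
lemma two_rpow_mul_exp_le {d : ℝ} (hd : 1 ≤ d) : (2 : ℝ) ^ d * Real.exp (-(6 * d)) ≤ 1 / 128 := by
  have he : (256 : ℝ) ≤ Real.exp 6 := by
    have h1 : (2.7 : ℝ) ≤ Real.exp 1 := by linarith [Real.exp_one_gt_d9]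
    calc (256 : ℝ) ≤ 2.7 ^ 6 := by norm_num
      _ ≤ Real.exp 1 ^ 6 := by gcongr
      _ = Real.exp 6 := by rw [← Real.exp_nat_mul]; norm_num
  have hl : Real.log 2 ≤ 1 := by linarith [Real.log_two_lt_d9]
  calc (2 : ℝ) ^ d * Real.exp (-(6 * d)) = Real.exp (d * (Real.log 2 - 6)) := by
        rw [Real.rpow_def_of_pos (by norm_num), ← Real.exp_add]; ring_nf
    _ ≤ Real.exp (1 * (Real.log 2 - 6)) := by
        apply Real.exp_le_exp.2; nlinarith
    _ = 2 * (Real.exp 6)⁻¹ := by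
        rw [one_mul, sub_eq_add_neg, Real.exp_add, Real.exp_log (by norm_num), Real.exp_neg]
    _ ≤ 2 * (256 : ℝ)⁻¹ := by gcongr
    _ = 1 / 128 := by norm_num

/-- A set of Assouad dimension `d` and radius `r` has, up to constants, projected radius at most
`d r / √D` in most directions. The exceptional set collects, at each scale, the edges between
a centre of the net and its children on which the projection exceeds its tail threshold. -/
lemma HasDoublingConst.exists_projection_bound {D M : ℕ} {S : Set (Space D)} {d : ℝ}
    (h : HasDoublingConst S M) (hM : (M : ℝ) = (2 : ℝ) ^ d) (hd : 1 ≤ d) (y : Space D) {r : ℝ}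
    (hr : 0 < r) :
    ∃ B : Set (Space D), dirLaw D B ≤ ENNReal.ofReal (1 / 24) ∧
      ∀ v ∉ B, ∀ x ∈ S, ‖x - y‖ ≤ r → |inner ℝ (x - y) v| ≤ 48 * d * r / Real.sqrt D := by
  classical
  set bad : ℕ → Space D → Space D → Set (Space D) := fun k c c' =>
    {v | (6 * d * (k + 1)) * (‖c' - c‖ / Real.sqrt D) < |inner ℝ (c' - c) v|} with hbad
  set B : Set (Space D) := ⋃ k : ℕ, ⋃ c ∈ h.net y r k, ⋃ c' ∈ h.centers c (r / 2 ^ k), bad k c c'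
    with hB
  refine ⟨B, ?_, ?_⟩
  · have hk : ∀ k : ℕ, dirLaw D (⋃ c ∈ h.net y r k, ⋃ c' ∈ h.centers c (r / 2 ^ k), bad k c c') ≤
        ENNReal.ofReal (4 * (1 / 128) * (1 / 128) ^ k) := by
      intro k
      set p := ENNReal.ofReal (4 * Real.exp (-(6 * d * (k + 1)))) with hp
      calc _ ≤ ∑ c ∈ h.net y r k, ∑ c' ∈ h.centers c (r / 2 ^ k), p := by
            refine (measure_biUnion_finset_le _ _).trans (Finset.sum_le_sum fun c _ => ?_)
            refine (measure_biUnion_finset_le _ _).trans (Finset.sum_le_sum fun c' _ => ?_)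
            exact dirLaw_inner_gt_le _ _
        _ ≤ ∑ c ∈ h.net y r k, (M : ENNReal) * p := by
            refine Finset.sum_le_sum fun c _ => ?_
            rw [Finset.sum_const, nsmul_eq_mul]
            gcongr
            exact_mod_cast h.card_centers_le _ _
        _ ≤ (M : ENNReal) ^ k * (M * p) := by
            rw [Finset.sum_const, nsmul_eq_mul]
            gcongr
            exact_mod_cast h.card_net_le y r k
        _ = ENNReal.ofReal (4 * ((M : ℝ) * Real.exp (-(6 * d))) ^ (k + 1)) := by
            have he : Real.exp (-(6 * d * (k + 1))) = Real.exp (-(6 * d)) ^ (k + 1) := by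
              rw [← Real.exp_nat_mul]; push_cast; ring_nf
            rw [hp, he, mul_pow, ← mul_assoc, ← pow_succ,
              ENNReal.ofReal_mul (by norm_num), ENNReal.ofReal_mul (by norm_num),
              ENNReal.ofReal_mul (by positivity),
              ENNReal.ofReal_pow (p := (M : ℝ)) (by positivity), ENNReal.ofReal_natCast]
            ring
        _ ≤ _ := by
            apply ENNReal.ofReal_le_ofReal
            rw [mul_assoc, ← pow_succ', hM]
            gcongr
            exact two_rpow_mul_exp_le hd
    calc dirLaw D B ≤ ∑' k : ℕ, ENNReal.ofReal (4 * (1 / 128) * (1 / 128) ^ k) :=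
          (measure_iUnion_le _).trans (ENNReal.tsum_le_tsum hk)
      _ = ENNReal.ofReal (∑' k : ℕ, 4 * (1 / 128) * (1 / 128 : ℝ) ^ k) := by
          rw [ENNReal.ofReal_tsum_of_nonneg (fun k => by positivity)]
          exact (summable_geometric_of_lt_one (by norm_num) (by norm_num)).mul_left _
      _ ≤ _ := by
          apply ENNReal.ofReal_le_ofReal
          rw [tsum_mul_left, tsum_geometric_of_lt_one (by norm_num) (by norm_num)]
          norm_num
  · intro v hv x hx hxy
    set ε : ℕ → ℝ := fun k => 12 * d * r / Real.sqrt D * (((k : ℝ) + 1) / 2 ^ k) with hε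
    -- Follow a chain of centres towards `x`, one scale at a time.
    have hchain : ∀ K : ℕ, ∃ c ∈ h.net y r K, ‖x - c‖ ≤ r / 2 ^ K ∧
        |inner ℝ (c - y) v| ≤ ∑ k ∈ Finset.range K, ε k := by
      intro K
      induction K with
      | zero => exact ⟨y, by simp [HasDoublingConst.net], by simpa using hxy, by simp⟩
      | succ K ih =>
        obtain ⟨c, hc, hxc, hcy⟩ := ih
        obtain ⟨c', hc', hxc'⟩ := h.exists_mem_centers (by positivity) hx hxc
        have hcc : ‖c' - c‖ ≤ 2 * (r / 2 ^ K) := by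
          have h1 : ‖c' - c‖ ≤ ‖x - c‖ + ‖x - c'‖ := by
            have : c' - c = (x - c) - (x - c') := by abel
            rw [this]; exact norm_sub_le _ _
          have h2 : 0 < r / 2 ^ K := by positivity
          linarith
        have hgood : |inner ℝ (c' - c) v| ≤ (6 * d * (K + 1)) * (‖c' - c‖ / Real.sqrt D) := by
          by_contra hcon
          exact hv (Set.mem_iUnion.2 ⟨K, Set.mem_biUnion hc (Set.mem_biUnion hc' (not_le.1 hcon))⟩)
        refine ⟨c', Finset.mem_biUnion.2 ⟨c, hc, hc'⟩, hxc'.trans_eq ?_, ?_⟩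
        · rw [pow_succ]; field_simp
        · rw [Finset.sum_range_succ]
          have hsplit : inner ℝ (c' - y) v = inner ℝ (c - y) v + inner ℝ (c' - c) v := by
            rw [← inner_add_left]; congr 1; abel
          rw [hsplit]
          refine (abs_add_le _ _).trans (add_le_add hcy (hgood.trans ?_))
          calc (6 * d * (K + 1)) * (‖c' - c‖ / Real.sqrt D)
              ≤ (6 * d * (K + 1)) * (2 * (r / 2 ^ K) / Real.sqrt D) := by gcongr
            _ = ε K := by simp only [hε]; ring
    have hbound : ∀ K : ℕ, |inner ℝ (x - y) v| ≤ 48 * d * r / Real.sqrt D + r * ‖v‖ * (1 / 2) ^ K := by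
      intro K
      obtain ⟨c, -, hxc, hcy⟩ := hchain K
      have hsplit : inner ℝ (x - y) v = inner ℝ (c - y) v + inner ℝ (x - c) v := by
        rw [← inner_add_left]; congr 1; abel
      rw [hsplit]
      refine (abs_add_le _ _).trans (add_le_add (hcy.trans ?_) ?_)
      · rw [← Finset.mul_sum]
        calc _ ≤ 12 * d * r / Real.sqrt D * 4 := by gcongr; exact sum_succ_div_two_pow_le K
          _ = _ := by ring
      · refine (abs_real_inner_le_norm _ _).trans ?_
        calc ‖x - c‖ * ‖v‖ ≤ r / 2 ^ K * ‖v‖ := by gcongr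
          _ = _ := by rw [one_div, inv_pow]; ring
    have hlim : Filter.Tendsto (fun K : ℕ => 48 * d * r / Real.sqrt D + r * ‖v‖ * (1 / 2 : ℝ) ^ K)
        Filter.atTop (nhds (48 * d * r / Real.sqrt D + r * ‖v‖ * 0)) :=
      ((tendsto_pow_atTop_nhds_zero_of_lt_one (by norm_num) (by norm_num)).const_mul _).const_add _
    have := ge_of_tendsto' hlim hbound
    simpa using this

/-! ### Order statistics and medians -/

/-- In a sorted list, the entries that satisfy a downward closed predicate are the first ones. -/
lemma sorted_getD_iff_lt_countP {L : List ℝ} (hL : L.Pairwise (· ≤ ·)) (p : ℝ → Bool)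
    (hp : ∀ x y, x ≤ y → p y → p x) {k : ℕ} (hk : k < L.length) :
    p (L.getD k 0) ↔ k < L.countP p := by
  induction L generalizing k with
  | nil => simp at hk
  | cons a L ih =>
    obtain ⟨ha, hL'⟩ := List.pairwise_cons.1 hL
    by_cases hpa : p a
    · rw [List.countP_cons_of_pos hpa]
      cases k with
      | zero => simp [hpa]
      | succ k =>
        rw [List.getD_cons_succ, ih hL' (by simpa using hk)]
        omega
    · have hnone : ∀ x ∈ L, ¬ p x := fun x hx hpx => hpa (hp _ _ (ha x hx) hpx)
      rw [List.countP_cons_of_neg hpa, List.countP_eq_zero.2 hnone]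
      cases k with
      | zero => simpa using hpa
      | succ k =>
        have hk' : k < L.length := by simpa using hk
        rw [List.getD_cons_succ, List.getD_eq_getElem _ _ hk']
        simpa using hnone _ (List.getElem_mem hk')

lemma sort_getD_iff_lt_countP (s : Multiset ℝ) (p : ℝ → Prop) [DecidablePred p]
    (hp : ∀ x y, x ≤ y → p y → p x) {k : ℕ} (hk : k < s.card) :
    p ((s.sort (· ≤ ·)).getD k 0) ↔ k < s.countP p := by
  have h := sorted_getD_iff_lt_countP (s.pairwise_sort (· ≤ ·)) (fun x => decide (p x))
    (by simpa using hp) (k := k) (by simpa using hk)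
  have h2 : s.countP p = (s.sort (· ≤ ·)).countP (fun x => decide (p x)) := by
    conv_lhs => rw [← s.sort_eq (· ≤ ·)]
    rw [Multiset.coe_countP]
  rw [h2, ← h]
  simp

/-- An interval that contains more than half of the elements contains the median. -/
lemma median_mem_Icc {s : Multiset ℝ} {a b : ℝ}
    (h : s.card < 2 * s.countP (fun x => a ≤ x ∧ x ≤ b)) : median s ∈ Set.Icc a b := by
  have hle : s.countP (fun x => a ≤ x ∧ x ≤ b) ≤ s.card := Multiset.countP_le_card _ _
  have hb : s.countP (fun x => a ≤ x ∧ x ≤ b) ≤ s.countP (fun x => x ≤ b) := by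
    rw [Multiset.countP_eq_card_filter, Multiset.countP_eq_card_filter]
    exact Multiset.card_le_card (Multiset.monotone_filter_right _ fun x hx => hx.2)
  have ha : s.countP (fun x => a ≤ x ∧ x ≤ b) + s.countP (fun x => x < a) ≤ s.card := by
    rw [s.card_eq_countP_add_countP (fun x => a ≤ x ∧ x ≤ b)]
    gcongr
    rw [Multiset.countP_eq_card_filter, Multiset.countP_eq_card_filter]
    exact Multiset.card_le_card (Multiset.monotone_filter_right _ fun x hx h => hx.not_ge h.1)
  have key : ∀ k, k < s.card → s.countP (fun x => x < a) ≤ k →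
      k < s.countP (fun x => x ≤ b) → (s.sort (· ≤ ·)).getD k 0 ∈ Set.Icc a b := by
    intro k hk h1 h2
    refine ⟨?_, ?_⟩
    · by_contra hcon
      have := (sort_getD_iff_lt_countP s (fun x => x < a)
        (fun x y hxy hy => hxy.trans_lt hy) hk).1 (not_le.1 hcon)
      omega
    · exact (sort_getD_iff_lt_countP s (fun x => x ≤ b)
        (fun x y hxy hy => hxy.trans hy) hk).2 h2
  have h1 := key ((s.card - 1) / 2) (by omega) (by omega) (by omega)
  have h2 := key (s.card / 2) (by omega) (by omega) (by omega)
  unfold median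
  constructor <;> [have := h1.1; have := h1.2] <;> [have := h2.1; have := h2.2] <;> linarith

lemma measurable_sort_getD {Ω ι : Type*} [MeasurableSpace Ω] (F : Finset ι) {f : ι → Ω → ℝ}
    (hf : ∀ i, Measurable (f i)) (k : ℕ) :
    Measurable fun ω => ((F.val.map fun i => f i ω).sort (· ≤ ·)).getD k 0 := by
  classical
  by_cases hk : k < F.card
  · refine measurable_of_Iic fun c => ?_
    have hset : (fun ω => ((F.val.map fun i => f i ω).sort (· ≤ ·)).getD k 0) ⁻¹' Set.Iic c =
        {ω | (k : ℕ) < ∑ i ∈ F, if f i ω ≤ c then 1 else 0} := by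
      ext ω
      have h := sort_getD_iff_lt_countP (F.val.map fun i => f i ω) (fun x => x ≤ c)
        (fun x y hxy hy => hxy.trans hy) (k := k) (by simpa using hk)
      rw [Set.mem_preimage, Set.mem_Iic, h, Multiset.countP_map, Set.mem_ofPred_eq,
        ← Finset.card_filter]
      rfl
    rw [hset]
    refine measurableSet_lt measurable_const (Finset.measurable_sum _ fun i _ => ?_)
    exact Measurable.ite (measurableSet_le (hf i) measurable_const) measurable_const
      measurable_const
  · have : (fun ω => ((F.val.map fun i => f i ω).sort (· ≤ ·)).getD k 0) = fun _ => 0 := by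
      funext ω
      exact List.getD_eq_default _ _ (by simpa using hk)
    rw [this]
    exact measurable_const

lemma measurable_median {Ω ι : Type*} [MeasurableSpace Ω] (F : Finset ι) {f : ι → Ω → ℝ}
    (hf : ∀ i, Measurable (f i)) : Measurable fun ω => median (F.val.map fun i => f i ω) := by
  unfold median
  simp only [Multiset.card_map]
  exact ((measurable_sort_getD F hf _).add (measurable_sort_getD F hf _)).div_const 2

/-! ### Separation by one random hyperplane -/

/-- The median of the projections of the sample points with index in `F`. -/
def idxMedian {D n : ℕ} (X : Fin n → Space D) (F : Finset (Fin n)) (v : Space D) : ℝ :=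
  median (F.val.map fun i => inner ℝ (X i) v)

lemma measurable_idxMedian {D n : ℕ} (X : Fin n → Space D) (F : Finset (Fin n)) :
    Measurable (idxMedian X F) :=
  measurable_median F fun i => by fun_prop

/-- Markov's inequality for a sum of squared projections. -/
lemma dirLaw_sum_sq_ge_le {D : ℕ} {ι : Type*} {F : Finset ι} (hF : F.Nonempty) {z : ι → Space D}
    {Δ c : ℝ} (hD : 0 < D) (hΔ : 0 < Δ) (hc : 0 < c) (hz : ∀ i ∈ F, ‖z i‖ ≤ Δ) :
    dirLaw D {v | c * (F.card * (Δ / Real.sqrt D) ^ 2) ≤ ∑ i ∈ F, inner ℝ (z i) v ^ 2} ≤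
      ENNReal.ofReal (1 / c) := by
  have hDr : (0 : ℝ) < Real.sqrt D := Real.sqrt_pos.2 (by exact_mod_cast hD)
  have hFc : (0 : ℝ) < F.card := by exact_mod_cast hF.card_pos
  set q : ℝ := F.card * (Δ / Real.sqrt D) ^ 2 with hq
  have hq0 : 0 < q := by positivity
  have hint : ∫⁻ v, ENNReal.ofReal (∑ i ∈ F, inner ℝ (z i) v ^ 2) ∂(dirLaw D) ≤
      ENNReal.ofReal q := by
    simp_rw [fun v : Space D => ENNReal.ofReal_sum_of_nonneg (s := F)
      (f := fun i => inner ℝ (z i) v ^ 2) fun i _ => sq_nonneg _]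
    rw [lintegral_finsetSum _ fun i _ => by fun_prop]
    calc _ ≤ ∑ i ∈ F, ENNReal.ofReal ((Δ / Real.sqrt D) ^ 2) := by
          refine Finset.sum_le_sum fun i hi => ?_
          rw [lintegral_inner_sq_dirLaw]
          apply ENNReal.ofReal_le_ofReal
          have := hz i hi
          gcongr
      _ = ENNReal.ofReal q := by
          rw [Finset.sum_const, nsmul_eq_mul, hq, ENNReal.ofReal_mul (by positivity),
            ENNReal.ofReal_natCast]
  have hset : {v | c * q ≤ ∑ i ∈ F, inner ℝ (z i) v ^ 2} ⊆
      {v | ENNReal.ofReal (c * q) ≤ ENNReal.ofReal (∑ i ∈ F, inner ℝ (z i) v ^ 2)} :=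
    fun v hv => ENNReal.ofReal_le_ofReal hv
  refine (measure_mono hset).trans ((meas_ge_le_lintegral_div ?_ ?_ ENNReal.ofReal_ne_top).trans ?_)
  · fun_prop
  · simpa using by positivity
  · refine (ENNReal.div_le_div_right hint _).trans ?_
    rw [← ENNReal.ofReal_div_of_pos (by positivity)]
    apply ENNReal.ofReal_le_ofReal
    rw [div_le_div_iff₀ (by positivity) hc]
    linarith

lemma idxMedian_mem_Icc {D n : ℕ} {X : Fin n → Space D} {F : Finset (Fin n)} {v : Space D}
    {p s : ℝ} (hs : 0 < s)
    (h : ∑ i ∈ F, (inner ℝ (X i) v - p) ^ 2 < 9 / 2 * (F.card * s ^ 2)) :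
    idxMedian X F v ∈ Set.Icc (p - 3 * s) (p + 3 * s) := by
  classical
  apply median_mem_Icc
  rw [Multiset.countP_map, Multiset.card_map]
  set P : Fin n → Prop := fun i => p - 3 * s ≤ inner ℝ (X i) v ∧ inner ℝ (X i) v ≤ p + 3 * s
    with hP
  change F.card < 2 * (F.filter P).card
  have hsplit := Finset.card_filter_add_card_filter_not (s := F) P
  have hout : (F.filter fun i => ¬ P i).card * (9 * s ^ 2) ≤
      ∑ i ∈ F, (inner ℝ (X i) v - p) ^ 2 := by
    rw [← nsmul_eq_mul, ← Finset.sum_const]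
    refine le_trans (Finset.sum_le_sum fun i hi => ?_)
      (Finset.sum_le_sum_of_subset_of_nonneg (Finset.filter_subset (fun i => ¬ P i) F)
        fun i _ _ => sq_nonneg _)
    have hi2 := (Finset.mem_filter.1 hi).2
    have : 3 * s ≤ |inner ℝ (X i) v - p| := by
      by_contra hcon
      obtain ⟨h1, h2⟩ := abs_lt.1 (not_le.1 hcon)
      exact hi2 ⟨by linarith, by linarith⟩
    rw [← sq_abs (_ - p)]
    nlinarith
  have hlt : ((F.filter fun i => ¬ P i).card : ℝ) * 2 < F.card := by
    have hs2 : 0 < s ^ 2 := by positivity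
    by_contra hcon
    push Not at hcon
    nlinarith
  have : (F.filter fun i => ¬ P i).card * 2 < F.card := by exact_mod_cast hlt
  omega

lemma offsetLaw_compl_Ico_le {a b : ℝ} (ha : -1 ≤ a) (hb : b ≤ 1) (hab : 1 / 96 ≤ b - a) :
    offsetLaw (Set.Ico a b)ᶜ ≤ ENNReal.ofReal (191 / 192) := by
  have h : offsetLaw (Set.Ico a b) = ENNReal.ofReal ((b - a) / 2) := by
    rw [offsetLaw, ProbabilityTheory.cond_apply measurableSet_Icc]
    have hsub : Set.Icc (-1 : ℝ) 1 ∩ Set.Ico a b = Set.Ico a b :=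
      Set.inter_eq_right.2 fun x hx => ⟨ha.trans hx.1, hx.2.le.trans hb⟩
    rw [hsub, Real.volume_Icc, Real.volume_Ico, ← ENNReal.ofReal_inv_of_pos (by norm_num),
      ← ENNReal.ofReal_mul (by norm_num)]
    congr 1; ring
  rw [measure_compl measurableSet_Ico (measure_ne_top _ _), measure_univ, h,
    ← ENNReal.ofReal_one, ← ENNReal.ofReal_sub _ (by linarith)]
  apply ENNReal.ofReal_le_ofReal
  linarith

/-- If `t` lies well between `p` and `q`, it separates what is near `p` from what is near `q`. -/
lemma not_iff_of_mem_Ico {p q t η a b : ℝ} (ht : t ∈ Set.Ico (min p q + η) (max p q - η))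
    (ha : |a - p| ≤ η) (hb : |b - q| ≤ η) : ¬ (a ≤ t ↔ b ≤ t) := by
  obtain ⟨h1, h2⟩ := ht
  obtain ⟨a1, a2⟩ := abs_le.1 ha
  obtain ⟨b1, b2⟩ := abs_le.1 hb
  intro hiff
  rcases le_total p q with hpq | hpq
  · rw [min_eq_left hpq] at h1
    rw [max_eq_right hpq] at h2
    have := hiff.1 (by linarith)
    linarith
  · rw [min_eq_right hpq] at h1
    rw [max_eq_left hpq] at h2
    have := hiff.2 (by linarith)
    linarith

/-- One noisy split at the median of the cell separates, with constant probability, the data in two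
given small balls that contain data at a distance exceeding half of the diameter. Most
directions keep the projections of both balls short, the projections of two representatives apart,
and the median within reach of the offset; the offset then falls between the two projected balls
with constant probability. -/
theorem exists_separating_event {D n M : ℕ} {S : Set (Space D)} {d : ℝ} (h : HasDoublingConst S M)
    (hM : (M : ℝ) = (2 : ℝ) ^ d) (hd : 1 ≤ d) {X : Fin n → Space D} (hX : ∀ i, X i ∈ S)
    {F : Finset (Fin n)} {Δ : ℝ} (hΔ : 0 < Δ) (hF : ∀ i ∈ F, ∀ j ∈ F, ‖X i - X j‖ ≤ Δ)
    (y y' : Space D) {r : ℝ} (hr : 0 < r) (hrd : d * r ≤ Δ / 4096) :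
    ∃ B : Set (Space D × ℝ), MeasurableSet B ∧ drawLaw D B ≤ ENNReal.ofReal (575 / 576) ∧
      ∀ w ∉ B, ∀ i ∈ F, ∀ j ∈ F, ‖X i - y‖ ≤ r → ‖X j - y'‖ ≤ r → Δ / 2 < ‖X i - X j‖ →
        ¬ (inner ℝ (X i) w.1 ≤ idxMedian X F w.1 + w.2 * (6 / Real.sqrt D * Δ) ↔
          inner ℝ (X j) w.1 ≤ idxMedian X F w.1 + w.2 * (6 / Real.sqrt D * Δ)) := by
  by_cases hex : ∃ i ∈ F, ∃ j ∈ F, ‖X i - y‖ ≤ r ∧ ‖X j - y'‖ ≤ r ∧ Δ / 2 < ‖X i - X j‖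
  swap
  · exact ⟨∅, MeasurableSet.empty, by simp, fun w _ i hi j hj h1 h2 h3 =>
      (hex ⟨i, hi, j, hj, h1, h2, h3⟩).elim⟩
  obtain ⟨i₀, hi₀, j₀, hj₀, hi₀y, hj₀y, hij⟩ := hex
  have hD : 0 < D := by
    rcases Nat.eq_zero_or_pos D with rfl | hD
    · have : X i₀ = X j₀ := Subsingleton.elim _ _
      rw [this, sub_self, norm_zero] at hij
      linarith
    · exact hD
  have hDr : (0 : ℝ) < Real.sqrt D := Real.sqrt_pos.2 (by exact_mod_cast hD)
  set s : ℝ := Δ / Real.sqrt D with hs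
  have hs0 : 0 < s := by positivity
  obtain ⟨B₁, hB₁, hB₁'⟩ := h.exists_projection_bound hM hd y hr
  obtain ⟨B₂, hB₂, hB₂'⟩ := h.exists_projection_bound hM hd y' hr
  -- Directions to avoid: `B₁`, `B₂` stretch a ball, `B₃` brings the representatives `X i₀`, `X j₀`
  -- together, `B₄` lets the median stray, `B₅` drives the representatives too far apart.
  set B₃ : Set (Space D) :=
    {v | |inner ℝ (X j₀ - X i₀) v| < (1 / 4) * (‖X j₀ - X i₀‖ / Real.sqrt D)} with hB₃
  set B₄ : Set (Space D) :=
    {v | 9 / 2 * (F.card * s ^ 2) ≤ ∑ i ∈ F, inner ℝ (X i - X i₀) v ^ 2} with hB₄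
  set B₅ : Set (Space D) :=
    {v | 9 * (({j₀} : Finset (Fin n)).card * s ^ 2) ≤
      ∑ j ∈ {j₀}, inner ℝ (X j - X i₀) v ^ 2} with hB₅
  set Bv : Set (Space D) := toMeasurable (dirLaw D) (B₁ ∪ B₂ ∪ B₃ ∪ B₄ ∪ B₅) with hBv
  have hBvm : MeasurableSet Bv := measurableSet_toMeasurable _ _
  have hBvle : dirLaw D Bv ≤ ENNReal.ofReal (2 / 3) := by
    rw [hBv, measure_toMeasurable]
    have h3 : dirLaw D B₃ ≤ ENNReal.ofReal (1 / 4) := dirLaw_inner_lt_le _ _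
    have h4 : dirLaw D B₄ ≤ ENNReal.ofReal (1 / (9 / 2)) :=
      dirLaw_sum_sq_ge_le ⟨i₀, hi₀⟩ hD hΔ (by norm_num) fun i hi => hF i hi i₀ hi₀
    have h5 : dirLaw D B₅ ≤ ENNReal.ofReal (1 / 9) :=
      dirLaw_sum_sq_ge_le ⟨j₀, Finset.mem_singleton_self _⟩ hD hΔ (by norm_num) fun j hj => by
        rw [Finset.mem_singleton.1 hj]; exact hF j₀ hj₀ i₀ hi₀
    calc _ ≤ dirLaw D B₁ + dirLaw D B₂ + dirLaw D B₃ + dirLaw D B₄ + dirLaw D B₅ := by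
          refine (measure_union_le _ _).trans ?_
          gcongr
          refine (measure_union_le _ _).trans ?_
          gcongr
          refine (measure_union_le _ _).trans ?_
          gcongr
          exact measure_union_le _ _
      _ ≤ ENNReal.ofReal (1 / 24) + ENNReal.ofReal (1 / 24) + ENNReal.ofReal (1 / 4) +
          ENNReal.ofReal (1 / (9 / 2)) + ENNReal.ofReal (1 / 9) := by gcongr
      _ = ENNReal.ofReal (2 / 3) := by
          rw [← ENNReal.ofReal_add (by norm_num) (by norm_num),
            ← ENNReal.ofReal_add (by norm_num) (by norm_num),
            ← ENNReal.ofReal_add (by norm_num) (by norm_num),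
            ← ENNReal.ofReal_add (by norm_num) (by norm_num)]
          norm_num
  set lo : Space D → ℝ := fun v => min (inner ℝ (X i₀) v) (inner ℝ (X j₀) v) with hlo
  set hi : Space D → ℝ := fun v => max (inner ℝ (X i₀) v) (inner ℝ (X j₀) v) with hhi
  -- The offsets in `[a v, b v)` put the threshold between the projected balls.
  set a : Space D → ℝ := fun v => (lo v + s / 32 - idxMedian X F v) / (6 * s) with ha
  set b : Space D → ℝ := fun v => (hi v - s / 32 - idxMedian X F v) / (6 * s) with hb
  have hmed := measurable_idxMedian X F
  have ham : Measurable a := by simp only [ha, hlo]; fun_prop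
  have hbm : Measurable b := by simp only [hb, hhi]; fun_prop
  set B : Set (Space D × ℝ) := {w | w.1 ∈ Bv ∨ ¬ (a w.1 ≤ w.2 ∧ w.2 < b w.1)} with hB
  have hBm : MeasurableSet B := by
    have e : B = (Prod.fst ⁻¹' Bv) ∪ ({w | a w.1 ≤ w.2} ∩ {w | w.2 < b w.1})ᶜ := by
      ext w; simp [hB]
    rw [e]
    exact (measurable_fst hBvm).union
      ((measurableSet_le (by fun_prop) (by fun_prop)).inter
        (measurableSet_lt (by fun_prop) (by fun_prop))).compl
  -- What a direction outside `Bv` guarantees.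
  have hgood : ∀ v ∉ Bv, v ∉ B₁ ∧ v ∉ B₂ ∧ -1 ≤ a v ∧ b v ≤ 1 ∧ 1 / 96 ≤ b v - a v := by
    intro v hv
    have hv' : v ∉ B₁ ∪ B₂ ∪ B₃ ∪ B₄ ∪ B₅ := fun hmem => hv (subset_toMeasurable _ _ hmem)
    simp only [Set.mem_union, not_or] at hv'
    obtain ⟨⟨⟨⟨h1, h2⟩, h3⟩, h4⟩, h5⟩ := hv'
    simp only [hB₃, hB₄, hB₅, Set.mem_ofPred_eq, not_lt, not_le, inner_sub_left,
      Finset.sum_singleton, Finset.card_singleton] at h3 h4 h5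
    obtain ⟨m1, m2⟩ := idxMedian_mem_Icc hs0 h4
    set p := inner ℝ (X i₀) v
    set p' := inner ℝ (X j₀) v
    have h5' : |p' - p| ≤ 3 * s := by
      apply abs_le_of_sq_le_sq _ (by positivity)
      push_cast at h5
      nlinarith
    have h3' : s / 8 ≤ |p' - p| := by
      refine le_trans ?_ h3
      rw [norm_sub_rev]
      calc s / 8 = 1 / 4 * (Δ / 2 / Real.sqrt D) := by rw [hs]; ring
        _ ≤ _ := by gcongr
    have hdiff : hi v - lo v = |p' - p| := max_sub_min_eq_abs _ _
    have hlop : p - 3 * s ≤ lo v := le_min (by linarith) (by linarith [(abs_le.1 h5').1])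
    have hhip : hi v ≤ p + 3 * s := max_le (by linarith) (by linarith [(abs_le.1 h5').2])
    refine ⟨h1, h2, ?_, ?_, ?_⟩
    · rw [ha, le_div_iff₀ (by positivity)]; linarith
    · rw [hb, div_le_iff₀ (by positivity)]; linarith
    · rw [ha, hb, ← sub_div, le_div_iff₀ (by positivity)]; linarith
  refine ⟨B, hBm, ?_, ?_⟩
  · rw [drawLaw_eq_prod, Measure.prod_apply hBm]
    calc _ ≤ ∫⁻ v, (ENNReal.ofReal (191 / 192) +
            Bv.indicator (fun _ => ENNReal.ofReal (1 / 192)) v) ∂(dirLaw D) := by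
          refine lintegral_mono fun v => ?_
          by_cases hv : v ∈ Bv
          · simp only [Set.indicator_of_mem hv]
            rw [← ENNReal.ofReal_add (by norm_num) (by norm_num)]
            norm_num
            exact prob_le_one
          · simp only [Set.indicator_of_notMem hv, add_zero]
            obtain ⟨-, -, g1, g2, g3⟩ := hgood v hv
            refine (measure_mono ?_).trans (offsetLaw_compl_Ico_le g1 g2 g3)
            intro u hu
            exact hu.resolve_left hv
      _ = ENNReal.ofReal (191 / 192) + ENNReal.ofReal (1 / 192) * dirLaw D Bv := by
          rw [lintegral_add_left measurable_const, lintegral_indicator_const hBvm]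
          simp
      _ ≤ ENNReal.ofReal (191 / 192) + ENNReal.ofReal (1 / 192) * ENNReal.ofReal (2 / 3) := by
          gcongr
      _ = _ := by
          rw [← ENNReal.ofReal_mul (by norm_num), ← ENNReal.ofReal_add (by norm_num) (by norm_num)]
          norm_num
  · rintro ⟨v, u⟩ hw i hiF j hjF hiy hjy -
    simp only [hB, Set.mem_ofPred_eq, not_or, not_not] at hw
    obtain ⟨hv, hau, hub⟩ := hw
    obtain ⟨h1, h2, -, -, -⟩ := hgood v hv
    have hε : 48 * d * r / Real.sqrt D ≤ s / 64 := by
      rw [hs, div_div, mul_comm (Real.sqrt D), ← div_div]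
      gcongr
      linarith
    have hclose : ∀ {x x' c : Space D}, |inner ℝ (x - c) v| ≤ 48 * d * r / Real.sqrt D →
        |inner ℝ (x' - c) v| ≤ 48 * d * r / Real.sqrt D →
        |inner ℝ x v - inner ℝ x' v| ≤ s / 32 := by
      intro x x' c h h'
      have e : inner ℝ x v - inner ℝ x' v = inner ℝ (x - c) v - inner ℝ (x' - c) v := by
        simp only [inner_sub_left]; ring
      rw [e]
      refine (abs_sub _ _).trans ?_
      linarith
    refine not_iff_of_mem_Ico (p := inner ℝ (X i₀) v) (q := inner ℝ (X j₀) v) (η := s / 32)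
      ⟨?_, ?_⟩ (hclose (hB₁' v h1 _ (hX i) hiy) (hB₁' v h1 _ (hX i₀) hi₀y))
      (hclose (hB₂' v h2 _ (hX j) hjy) (hB₂' v h2 _ (hX j₀) hj₀y))
    · rw [ha, div_le_iff₀ (by positivity)] at hau
      have e : 6 / Real.sqrt D * Δ = 6 * s := by rw [hs]; ring
      change lo v + s / 32 ≤ idxMedian X F v + u * (6 / Real.sqrt D * Δ)
      rw [e]; linarith
    · rw [hb, lt_div_iff₀ (by positivity)] at hub
      have e : 6 / Real.sqrt D * Δ = 6 * s := by rw [hs]; ring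
      change idxMedian X F v + u * (6 / Real.sqrt D * Δ) < hi v - s / 32
      rw [e]; linarith

/-! ### The algorithm on sample indices -/

/-- What the algorithm knows about a node: its address and the indices of the sample points in its
cell. Codes form a countable type, which makes the course of the algorithm measurable. -/
abbrev Code (n : ℕ) := List Bool × Finset (Fin n)

open Classical in
/-- The indices of the sample points in `A`. -/
def idx {D n : ℕ} (X : Fin n → Space D) (A : Set (Space D)) : Finset (Fin n) :=
  Finset.univ.filter fun i => X i ∈ A

lemma mem_idx {D n : ℕ} {X : Fin n → Space D} {A : Set (Space D)} {i : Fin n} :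
    i ∈ idx X A ↔ X i ∈ A := by simp [idx]

/-- The code of a node. -/
def Node.code {D n : ℕ} (X : Fin n → Space D) (N : Node D) : Code n := (N.addr, idx X N.cell)

/-- The diameter of the sample points with index in `F`. -/
def idxDiam {D n : ℕ} (X : Fin n → Space D) (F : Finset (Fin n)) : ℝ :=
  Metric.diam (X '' (F : Set (Fin n)))

lemma dataDiam_eq_idxDiam {D n : ℕ} (X : Fin n → Space D) (A : Set (Space D)) :
    dataDiam X A = idxDiam X (idx X A) := by
  unfold dataDiam idxDiam
  congr 1
  ext x
  simp only [Set.mem_inter_iff, Set.mem_range, Set.mem_image, Finset.mem_coe, mem_idx]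
  constructor
  · rintro ⟨hx, i, rfl⟩
    exact ⟨i, hx, rfl⟩
  · rintro ⟨i, hi, rfl⟩
    exact ⟨hi, i, rfl⟩

lemma empMass_eq_card_idx {D n : ℕ} (X : Fin n → Space D) (A : Set (Space D)) :
    empMass X A = ((idx X A).card : ℝ) / n := by
  classical
  unfold empMass
  rw [Nat.card_eq_fintype_card, Fintype.card_subtype]
  congr! 3

lemma projMedian_eq_idxMedian {D n : ℕ} (X : Fin n → Space D) (A : Set (Space D)) (v : Space D) :
    projMedian X A v = idxMedian X (idx X A) v := rfl

/-- `avgDiam` in terms of codes. -/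
def codeAvgDiam {D n : ℕ} (X : Fin n → Space D) (P : List (Code n)) : ℝ :=
  Real.sqrt ((P.map fun c => (c.2.card : ℝ) / n * idxDiam X c.2 ^ 2).sum /
    (P.map fun c => (c.2.card : ℝ) / n).sum)

lemma avgDiam_eq_codeAvgDiam {D n : ℕ} (X : Fin n → Space D) (P : List (Node D)) :
    avgDiam X P = codeAvgDiam X (P.map (Node.code X)) := by
  unfold avgDiam codeAvgDiam
  simp only [List.map_map, Function.comp_def, Node.code, empMass_eq_card_idx, dataDiam_eq_idxDiam]

/-- `Node.split` in terms of codes. -/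
def codeSplit {D n : ℕ} (X : Fin n → Space D) (c : Code n) (v : Space D) (t : ℝ) : List (Code n) :=
  [(false :: c.1, c.2.filter fun i => inner ℝ (X i) v ≤ t),
   (true :: c.1, c.2 \ c.2.filter fun i => inner ℝ (X i) v ≤ t)]

lemma map_code_split {D n : ℕ} (X : Fin n → Space D) (N : Node D) (v : Space D) (t : ℝ) :
    (N.split v t).map (Node.code X) = codeSplit X (N.code X) v t := by
  have h1 : idx X {x ∈ N.cell | inner ℝ x v ≤ t} =
      (idx X N.cell).filter fun i => inner ℝ (X i) v ≤ t := by
    ext i; simp [mem_idx]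
  have h2 : idx X (N.cell \ {x ∈ N.cell | inner ℝ x v ≤ t}) =
      idx X N.cell \ (idx X N.cell).filter fun i => inner ℝ (X i) v ≤ t := by
    ext i
    simp only [mem_idx, Set.mem_sdiff, Set.mem_ofPred_eq, Finset.mem_sdiff, Finset.mem_filter]
  simp only [Node.split, codeSplit, Node.code, List.map_cons, List.map_nil, h1, h2]

/-- `threshold` in terms of codes. -/
def codeThreshold {D n : ℕ} (X : Fin n → Space D) (F₀ F : Finset (Fin n)) (l i : ℕ)
    (v : Space D) (u : ℝ) : ℝ :=
  if Odd (l + i) then idxMedian X F₀ v + u * (6 / Real.sqrt D * idxDiam X F₀)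
  else idxMedian X F v

lemma threshold_eq_codeThreshold {D n : ℕ} (X : Fin n → Space D) (A₀ A : Set (Space D)) (l i : ℕ)
    (v : Space D) (u : ℝ) :
    threshold X A₀ A l i v u = codeThreshold X (idx X A₀) (idx X A) l i v u := by
  unfold threshold codeThreshold
  rw [dataDiam_eq_idxDiam, projMedian_eq_idxMedian, projMedian_eq_idxMedian]

/-- `basicPartition` in terms of codes. -/
def codePartition {D n : ℕ} (X : Fin n → Space D) (c₀ : Code n) (l : ℕ)
    (w : ℕ → Space D × ℝ) : ℕ → List (Code n)
  | 0 => [c₀]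
  | i + 1 => (codePartition X c₀ l w i).flatMap fun c =>
      codeSplit X c (w i).1 (codeThreshold X c₀.2 c.2 l (i + 1) (w i).1 (w i).2)

lemma map_code_basicPartition {D n : ℕ} (X : Fin n → Space D) (N₀ : Node D) (l : ℕ)
    (w : ℕ → Space D × ℝ) (i : ℕ) :
    (basicPartition X N₀ l w i).map (Node.code X) = codePartition X (N₀.code X) l w i := by
  induction i with
  | zero => rfl
  | succ i ih =>
    rw [basicPartition, codePartition, ← ih, List.map_flatMap, List.flatMap_map]
    simp only [map_code_split, threshold_eq_codeThreshold]
    rfl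

/-- `basicDepth` in terms of codes. -/
def codeDepth {D n : ℕ} (X : Fin n → Space D) (c₀ : Code n) (Δ : ℝ) (l : ℕ)
    (w : ℕ → Space D × ℝ) : ℕ∞ :=
  sInf ((fun i : ℕ => (i : ℕ∞)) '' {i : ℕ | codeAvgDiam X (codePartition X c₀ l w i) ≤ Δ})

lemma basicDepth_eq_codeDepth {D n : ℕ} (X : Fin n → Space D) (N₀ : Node D) (Δ : ℝ) (l : ℕ)
    (w : ℕ → Space D × ℝ) : basicDepth X N₀ Δ l w = codeDepth X (N₀.code X) Δ l w := by
  unfold basicDepth codeDepth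
  simp only [avgDiam_eq_codeAvgDiam, map_code_basicPartition]

lemma argmin_map {α β γ : Type*} [LinearOrder γ] (g : α → β) (f : β → γ) (l : List α) :
    (l.map g).argmin f = (l.argmin fun a => f (g a)).map g := by
  induction l with
  | nil => rfl
  | cons a l ih =>
    rw [List.map_cons, List.argmin_cons, List.argmin_cons, ih]
    cases l.argmin (fun a => f (g a)) with
    | none => rfl
    | some b => simp only [Option.map_some]; split_ifs <;> rfl

lemma argmin_congr {α γ : Type*} [LinearOrder γ] {f g : α → γ} {l : List α}
    (h : ∀ a ∈ l, f a = g a) : l.argmin f = l.argmin g := by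
  induction l with
  | nil => rfl
  | cons a l ih =>
    rw [List.argmin_cons, List.argmin_cons, ih fun b hb => h b (List.mem_cons_of_mem _ hb),
      h a List.mem_cons_self]
    cases hb : l.argmin g with
    | none => rfl
    | some b =>
      simp only
      rw [h b (List.mem_cons_of_mem _ (List.argmin_mem hb))]

/-- The index of the first shortest among `R` runs of the given depths. -/
def bestRun (R : ℕ) (f : ℕ → ℕ∞) : ℕ := ((List.range R).argmin f).getD 0

/-- The depth of run `j` of the call of `coreRPtree` at a node of code `c`. -/
def runDepth {D n : ℕ} (X : Fin n → Space D) (c : Code n) (ω : Tape D) (j : ℕ) : ℕ∞ :=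
  codeDepth X c (idxDiam X c.2 / 2) c.1.length fun i => ω (c.1, j, i)

/-- The run whose tree is returned by the call of `coreRPtree` at a node of code `c`. -/
def coreRun {D n : ℕ} (X : Fin n → Space D) (δ : ℝ) (ω : Tape D) (c : Code n) : ℕ :=
  bestRun (numRuns n δ) (runDepth X c ω)

/-- The leaves returned by the call of `coreRPtree` at a node of code `c`. -/
def codeLeaves {D n : ℕ} (X : Fin n → Space D) (δ : ℝ) (ω : Tape D) (c : Code n) :
    List (Code n) :=
  codePartition X c c.1.length (fun i => ω (c.1, coreRun X δ ω c, i))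
    (runDepth X c ω (coreRun X δ ω c)).toNat

lemma coreCall_eq_basicRPtree {D n : ℕ} (X : Fin n → Space D) (δ : ℝ) (ω : Tape D) (N : Node D) :
    coreCall X δ ω N = basicRPtree X N (dataDiam X N.cell / 2) N.level
      fun i => ω (N.addr, coreRun X δ ω (N.code X), i) := by
  have hd : ∀ j, (basicRPtree X N (dataDiam X N.cell / 2) N.level fun i => ω (N.addr, j, i)).depth
      = runDepth X (N.code X) ω j := by
    intro j
    simp only [basicRPtree, basicDepth_eq_codeDepth, dataDiam_eq_idxDiam]
    rfl
  unfold coreCall coreRPtree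
  rw [argmin_map]
  simp only [hd]
  unfold coreRun bestRun
  cases (List.range (numRuns n δ)).argmin (runDepth X (N.code X) ω) <;> rfl

lemma coreCall_depth {D n : ℕ} (X : Fin n → Space D) (δ : ℝ) (ω : Tape D) (N : Node D) :
    (coreCall X δ ω N).depth = runDepth X (N.code X) ω (coreRun X δ ω (N.code X)) := by
  rw [coreCall_eq_basicRPtree]
  simp only [basicRPtree, basicDepth_eq_codeDepth, dataDiam_eq_idxDiam]
  rfl

lemma map_code_leaves_coreCall {D n : ℕ} (X : Fin n → Space D) (δ : ℝ) (ω : Tape D) (N : Node D) :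
    (coreCall X δ ω N).leaves.map (Node.code X) = codeLeaves X δ ω (N.code X) := by
  rw [coreCall_eq_basicRPtree]
  simp only [basicRPtree, map_code_basicPartition, basicDepth_eq_codeDepth, dataDiam_eq_idxDiam]
  rfl

/-- `adaptivePartition` in terms of codes. -/
def adaptiveCodes {D n : ℕ} (X : Fin n → Space D) (δ : ℝ) (ω : Tape D) : ℕ → List (Code n)
  | 0 => [([], Finset.univ)]
  | i + 1 => (adaptiveCodes X δ ω i).flatMap (codeLeaves X δ ω)

lemma map_code_adaptivePartition {D n : ℕ} {X : Fin n → Space D} {S : Set (Space D)}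
    (hX : ∀ i, X i ∈ S) (δ : ℝ) (ω : Tape D) (i : ℕ) :
    (adaptivePartition X S δ ω i).map (Node.code X) = adaptiveCodes X δ ω i := by
  induction i with
  | zero =>
    have : idx X S = Finset.univ := by ext i; simp [mem_idx, hX i]
    simp [adaptivePartition, adaptiveCodes, Node.code, this]
  | succ i ih =>
    rw [adaptivePartition, adaptiveCodes, ← ih, List.map_flatMap, List.flatMap_map]
    simp only [map_code_leaves_coreCall]

/-! ### Measurability of the course of the algorithm -/

instance measurableSpaceListCode (n : ℕ) : MeasurableSpace (List (Code n)) := ⊤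

instance discreteMeasurableSpaceListCode (n : ℕ) : DiscreteMeasurableSpace (List (Code n)) :=
  ⟨fun _ => trivial⟩

lemma measurable_eval_countable {Ω α β : Type*} [MeasurableSpace Ω] [MeasurableSpace α]
    [MeasurableSpace β] [Countable α] [MeasurableSingletonClass α] {f : Ω → α} (hf : Measurable f)
    {g : α → Ω → β} (hg : ∀ a, Measurable (g a)) : Measurable fun ω => g (f ω) ω :=
  (measurable_from_prod_countable_right (f := fun p : α × Ω => g p.1 p.2) hg).comp
    (hf.prodMk measurable_id)

lemma measurable_flatMap {Ω : Type*} [MeasurableSpace Ω] {n : ℕ} {L : Ω → List (Code n)}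
    (hL : Measurable L) {g : Code n → Ω → List (Code n)} (hg : ∀ c, Measurable (g c)) :
    Measurable fun ω => (L ω).flatMap fun c => g c ω := by
  refine measurable_eval_countable (g := fun P ω => P.flatMap fun c => g c ω) hL fun P => ?_
  induction P with
  | nil => simp
  | cons c P ih =>
    simp only [List.flatMap_cons]
    exact (measurable_of_countable fun p : List (Code n) × List (Code n) => p.1 ++ p.2).comp
      ((hg c).prodMk ih)

lemma measurable_codeSplit {Ω : Type*} [MeasurableSpace Ω] {D n : ℕ} (X : Fin n → Space D)
    (c : Code n) {v : Ω → Space D} {t : Ω → ℝ} (hv : Measurable v) (ht : Measurable t) :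
    Measurable fun ω => codeSplit X c (v ω) (t ω) := by
  let m : MeasurableSpace (Finset (Fin n)) := ⊤
  have hm : DiscreteMeasurableSpace (Finset (Fin n)) := ⟨fun _ => trivial⟩
  have hf : Measurable fun ω => c.2.filter fun i => inner ℝ (X i) (v ω) ≤ t ω := by
    refine measurable_to_countable' fun G => ?_
    have hset : (fun ω => c.2.filter fun i => inner ℝ (X i) (v ω) ≤ t ω) ⁻¹' {G} =
        ⋂ i, {ω | (i ∈ c.2 ∧ inner ℝ (X i) (v ω) ≤ t ω) ↔ i ∈ G} := by
      ext ω
      simp [Finset.ext_iff]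
    rw [hset]
    refine MeasurableSet.iInter fun i => ?_
    have h1 : MeasurableSet {ω | i ∈ c.2 ∧ inner ℝ (X i) (v ω) ≤ t ω} :=
      (MeasurableSet.const _).inter (measurableSet_le (by fun_prop) ht)
    by_cases hi : i ∈ G
    · simpa [hi] using h1
    · simp only [hi, iff_false]
      exact h1.compl
  exact (measurable_of_countable fun G : Finset (Fin n) =>
    [((false :: c.1, G) : Code n), (true :: c.1, c.2 \ G)]).comp hf

lemma measurable_codePartition {Ω : Type*} [MeasurableSpace Ω] {D n : ℕ} (X : Fin n → Space D)
    (c₀ : Code n) (l : ℕ) {w : Ω → ℕ → Space D × ℝ} (hw : ∀ i, Measurable fun ω => w ω i) (i : ℕ) :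
    Measurable fun ω => codePartition X c₀ l (w ω) i := by
  induction i with
  | zero => exact measurable_const
  | succ i ih =>
    refine measurable_flatMap ih fun c => measurable_codeSplit X c (hw i).fst ?_
    unfold codeThreshold
    split_ifs
    · exact ((measurable_idxMedian X _).comp (hw i).fst).add ((hw i).snd.mul_const _)
    · exact (measurable_idxMedian X _).comp (hw i).fst

lemma measurable_codeDepth {Ω : Type*} [MeasurableSpace Ω] {D n : ℕ} (X : Fin n → Space D)
    (c₀ : Code n) (Δ : ℝ) (l : ℕ) {w : Ω → ℕ → Space D × ℝ}
    (hw : ∀ i, Measurable fun ω => w ω i) :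
    Measurable fun ω => codeDepth X c₀ Δ l (w ω) := by
  classical
  have h : (fun ω => codeDepth X c₀ Δ l (w ω)) = fun ω => ⨅ i : ℕ,
      (if codeAvgDiam X (codePartition X c₀ l (w ω) i) ≤ Δ then (i : ℕ∞) else ⊤) := by
    funext ω
    rw [codeDepth, sInf_image]
    refine iInf_congr fun i => ?_
    split_ifs with hi
    · exact iInf_pos hi
    · exact iInf_neg hi
  rw [h]
  have hborel : BorelSpace ℕ∞ := ⟨borel_eq_top_of_countable.symm⟩
  refine Measurable.iInf fun i => ?_
  exact (measurable_of_countable fun P : List (Code n) =>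
    if codeAvgDiam X P ≤ Δ then (i : ℕ∞) else ⊤).comp (measurable_codePartition X c₀ l hw i)

lemma measurable_bestRun {Ω : Type*} [MeasurableSpace Ω] (R : ℕ) {f : Ω → ℕ → ℕ∞}
    (hf : ∀ j, Measurable fun ω => f ω j) : Measurable fun ω => bestRun R (f ω) := by
  have h : (fun ω => bestRun R (f ω)) = fun ω =>
      (fun a : Fin R → ℕ∞ => bestRun R fun j => if h : j < R then a ⟨j, h⟩ else 0)
        fun j => f ω j := by
    funext ω
    simp only [bestRun]
    congr 1
    refine argmin_congr fun j hj => ?_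
    rw [dif_pos (List.mem_range.1 hj)]
  rw [h]
  exact (measurable_of_countable fun a : Fin R → ℕ∞ =>
    bestRun R fun j => if h : j < R then a ⟨j, h⟩ else 0).comp
      (measurable_pi_lambda _ fun j => hf j)

lemma measurable_runDepth {D n : ℕ} (X : Fin n → Space D) (c : Code n) (j : ℕ) :
    Measurable fun ω => runDepth X c ω j :=
  measurable_codeDepth X c _ _ fun i => measurable_pi_apply (c.1, j, i)

lemma measurable_codeLeaves {D n : ℕ} (X : Fin n → Space D) (δ : ℝ) (c : Code n) :
    Measurable fun ω => codeLeaves X δ ω c := by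
  refine measurable_eval_countable (f := fun ω => coreRun X δ ω c)
    (g := fun j ω => codePartition X c c.1.length (fun i => ω (c.1, j, i)) (runDepth X c ω j).toNat)
    (measurable_bestRun _ fun j => measurable_runDepth X c j) fun j => ?_
  exact measurable_eval_countable (f := fun ω => runDepth X c ω j)
    (g := fun m ω => codePartition X c c.1.length (fun i => ω (c.1, j, i)) m.toNat)
    (measurable_runDepth X c j)
    fun m => measurable_codePartition X c _ (fun i => measurable_pi_apply (c.1, j, i)) _

lemma measurable_adaptiveCodes {D n : ℕ} (X : Fin n → Space D) (δ : ℝ) (i : ℕ) :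
    Measurable fun ω => adaptiveCodes X δ ω i := by
  induction i with
  | zero => exact measurable_const
  | succ i ih => exact measurable_flatMap ih fun c => measurable_codeLeaves X δ c

/-! ### The depth of one call -/

/-- Sample points that share a cell lie on the same side of the hyperplane of every noisy round. -/
lemma same_side_of_mem_codePartition {D n : ℕ} {X : Fin n → Space D} {c₀ : Code n} {l : ℕ}
    {w : ℕ → Space D × ℝ} {i : ℕ} {c : Code n} (hc : c ∈ codePartition X c₀ l w i) :
    c.2 ⊆ c₀.2 ∧ ∀ a ∈ c.2, ∀ b ∈ c.2, ∀ j < i, Odd (l + (j + 1)) →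
      (inner ℝ (X a) (w j).1 ≤
          idxMedian X c₀.2 (w j).1 + (w j).2 * (6 / Real.sqrt D * idxDiam X c₀.2) ↔
        inner ℝ (X b) (w j).1 ≤
          idxMedian X c₀.2 (w j).1 + (w j).2 * (6 / Real.sqrt D * idxDiam X c₀.2)) := by
  induction i generalizing c with
  | zero =>
    rw [codePartition, List.mem_singleton] at hc
    subst hc
    exact ⟨subset_rfl, fun _ _ _ _ j hj => absurd hj (Nat.not_lt_zero j)⟩
  | succ i ih =>
    rw [codePartition, List.mem_flatMap] at hc
    obtain ⟨c', hc', hcc'⟩ := hc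
    obtain ⟨hsub, hside⟩ := ih hc'
    simp only [codeSplit, List.mem_cons, List.not_mem_nil, or_false] at hcc'
    have hcsub : c.2 ⊆ c'.2 := by
      rcases hcc' with rfl | rfl
      · exact Finset.filter_subset _ _
      · exact Finset.sdiff_subset
    refine ⟨hcsub.trans hsub, fun a ha b hb j hj hodd => ?_⟩
    rcases Nat.lt_succ_iff_lt_or_eq.1 hj with hj | rfl
    · exact hside a (hcsub ha) b (hcsub hb) j hj hodd
    · rcases hcc' with rfl | rfl
      · simp only [codeThreshold, if_pos hodd, Finset.mem_filter] at ha hb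
        exact iff_of_true ha.2 hb.2
      · simp only [codeThreshold, if_pos hodd, Finset.mem_sdiff, Finset.mem_filter, not_and] at ha hb
        exact iff_of_false (ha.2 ha.1) (hb.2 hb.1)

lemma dist_le_idxDiam {D n : ℕ} (X : Fin n → Space D) {F : Finset (Fin n)} {i j : Fin n}
    (hi : i ∈ F) (hj : j ∈ F) : ‖X i - X j‖ ≤ idxDiam X F := by
  rw [← dist_eq_norm]
  exact Metric.dist_le_diam_of_mem (F.finite_toSet.image X).isBounded
    (Set.mem_image_of_mem X hi) (Set.mem_image_of_mem X hj)

lemma idxDiam_nonneg {D n : ℕ} (X : Fin n → Space D) (F : Finset (Fin n)) : 0 ≤ idxDiam X F :=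
  Metric.diam_nonneg

lemma codeAvgDiam_le {D n : ℕ} {X : Fin n → Space D} {P : List (Code n)} {Δ : ℝ} (hΔ : 0 ≤ Δ)
    (h : ∀ c ∈ P, idxDiam X c.2 ≤ Δ) : codeAvgDiam X P ≤ Δ := by
  rw [codeAvgDiam, Real.sqrt_le_left hΔ]
  refine div_le_of_le_mul₀ (List.sum_nonneg fun x hx => ?_) (by positivity) ?_
  · obtain ⟨c, -, rfl⟩ := List.mem_map.1 hx
    positivity
  · rw [← List.sum_map_mul_left]
    refine List.sum_le_sum fun c hc => ?_
    rw [mul_comm]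
    have := h c hc
    have := idxDiam_nonneg X c.2
    gcongr

lemma codeDepth_le {D n : ℕ} {X : Fin n → Space D} {c₀ : Code n} {Δ : ℝ} {l : ℕ}
    {w : ℕ → Space D × ℝ} {i : ℕ} (h : codeAvgDiam X (codePartition X c₀ l w i) ≤ Δ) :
    codeDepth X c₀ Δ l w ≤ i :=
  sInf_le ⟨i, h, rfl⟩

lemma card_odd_rounds (l m : ℕ) :
    ((Finset.range (2 * m)).filter fun i => Odd (l + (i + 1))).card = m := by
  induction m with
  | zero => simp
  | succ m ih =>
    have e : 2 * (m + 1) = 2 * m + 1 + 1 := by ring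
    rw [e, Finset.range_add_one, Finset.range_add_one, Finset.filter_insert, Finset.filter_insert]
    have hn : 2 * m ∉ (Finset.range (2 * m)).filter fun i => Odd (l + (i + 1)) := by simp
    have hn' : 2 * m + 1 ∉ (Finset.range (2 * m)).filter fun i => Odd (l + (i + 1)) := by simp
    rcases Nat.even_or_odd l with hl | hl
    · have h1 : Odd (l + (2 * m + 1)) := by grind
      have h2 : ¬ Odd (l + (2 * m + 1 + 1)) := by grind
      rw [if_neg h2, if_pos h1, Finset.card_insert_of_notMem hn, ih]
    · have h1 : ¬ Odd (l + (2 * m + 1)) := by grind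
      have h2 : Odd (l + (2 * m + 1 + 1)) := by grind
      rw [if_pos h2, if_neg h1, Finset.card_insert_of_notMem hn', ih]

lemma bestRun_le {R : ℕ} {f : ℕ → ℕ∞} {j : ℕ} (hj : j < R) : f (bestRun R f) ≤ f j := by
  unfold bestRun
  cases h : (List.range R).argmin f with
  | none =>
    rw [List.argmin_eq_none] at h
    have : j ∈ List.range R := List.mem_range.2 hj
    simp [h] at this
  | some m => exact List.le_of_mem_argmin (List.mem_range.2 hj) h

/-- The σ-algebra of the draws with index in `K`. -/
abbrev drawAlgebra (D : ℕ) (K : Set (List Bool × ℕ × ℕ)) : MeasurableSpace (Tape D) :=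
  ⨆ k ∈ K, MeasurableSpace.comap (fun ω => ω k) inferInstance

lemma drawAlgebra_le (D : ℕ) (K : Set (List Bool × ℕ × ℕ)) :
    drawAlgebra D K ≤ MeasurableSpace.pi :=
  iSup₂_le fun k _ => (measurable_pi_apply k).comap_le

lemma measurableSet_drawAlgebra {D : ℕ} {K : Set (List Bool × ℕ × ℕ)} {k : List Bool × ℕ × ℕ}
    (hk : k ∈ K) {B : Set (Space D × ℝ)} (hB : MeasurableSet B) :
    MeasurableSet[drawAlgebra D K] {ω : Tape D | ω k ∈ B} :=
  le_iSup₂ (f := fun k (_ : k ∈ K) => MeasurableSpace.comap (fun ω : Tape D => ω k) inferInstance)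
    k hk _ ⟨B, hB, rfl⟩

/-- Union bound over the choice, in each of `R` runs, of one of the events indexed by `N`, which
then has to occur in every round of `O`. -/
lemma tapeLaw_runs_le {D : ℕ} {ι : Type*} (N : Finset ι) {B : ι → Set (Space D × ℝ)}
    (hB : ∀ p, MeasurableSet (B p)) {q : ENNReal} (hq : ∀ p, drawLaw D (B p) ≤ q)
    (a : List Bool) (O : Finset ℕ) (R : ℕ) :
    tapeLaw D {ω | ∀ j < R, ∃ p ∈ N, ∀ i ∈ O, ω (a, j, i) ∈ B p} ≤
      (N.card * q ^ O.card) ^ R := by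
  classical
  set s : Finset (List Bool × ℕ × ℕ) := {a} ×ˢ (Finset.range R ×ˢ O) with hs
  set t : (Fin R → ι) → (List Bool × ℕ × ℕ) → Set (Space D × ℝ) := fun φ k =>
    if h : k.2.1 < R then B (φ ⟨k.2.1, h⟩) else Set.univ with ht
  have hsub : {ω : Tape D | ∀ j < R, ∃ p ∈ N, ∀ i ∈ O, ω (a, j, i) ∈ B p} ⊆
      ⋃ φ ∈ Fintype.piFinset (fun _ : Fin R => N), Set.pi (s : Set _) (t φ) := by
    intro ω hω
    choose φ hφN hφ using fun j : Fin R => hω j j.2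
    refine Set.mem_biUnion (x := φ) (Fintype.mem_piFinset.2 hφN) ?_
    rintro ⟨a', j, i⟩ hk
    simp only [hs, Finset.coe_product, Set.mem_prod, Finset.mem_coe, Finset.mem_singleton,
      Finset.mem_range] at hk
    obtain ⟨rfl, hj, hi⟩ := hk
    simp only [ht, dif_pos hj]
    exact hφ ⟨j, hj⟩ i hi
  have hbox : ∀ φ, tapeLaw D (Set.pi (s : Set _) (t φ)) ≤ q ^ (R * O.card) := by
    intro φ
    have htm : ∀ k ∈ s, MeasurableSet (t φ k) := by
      intro k _
      simp only [ht]
      split_ifs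
      · exact hB _
      · exact MeasurableSet.univ
    have hcard : s.card = R * O.card := by simp [hs]
    rw [tapeLaw, Measure.infinitePi_pi _ htm, ← hcard]
    refine Finset.prod_le_pow_card _ _ _ fun k hk => ?_
    have hkR : k.2.1 < R := by
      simp only [hs, Finset.mem_product, Finset.mem_range] at hk
      exact hk.2.1
    simp only [ht, dif_pos hkR]
    exact hq _
  refine (measure_mono hsub).trans ((measure_biUnion_finset_le _ _).trans ?_)
  refine (Finset.sum_le_sum fun φ _ => hbox φ).trans_eq ?_
  rw [Finset.sum_const, nsmul_eq_mul, Fintype.card_piFinset_const, mul_pow, ← pow_mul, mul_comm R]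
  push_cast
  rfl

/-- A call of `coreRPtree` at a cell with data of positive diameter returns a tree of depth at most
`2 m` except with probability `2 ^ (-R)`, where `R` is the number of runs. If a run is deeper, some
pair of balls of radius `Δ / 2 ^ J` is separated by none of its `m` noisy hyperplanes. -/
theorem exists_call_event {D n M : ℕ} {S : Set (Space D)} {d : ℝ} (h : HasDoublingConst S M)
    (hM : (M : ℝ) = (2 : ℝ) ^ d) (hd : 1 ≤ d) {X : Fin n → Space D} (hX : ∀ i, X i ∈ S)
    {J m : ℕ} (hJ : 4096 * d ≤ 2 ^ J) (hm : ((M : ℝ) ^ J) ^ 2 * (575 / 576) ^ m ≤ 1 / 2)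
    (δ : ℝ) {c : Code n} (hc : 0 < idxDiam X c.2) :
    ∃ B : Set (Tape D), MeasurableSet[drawAlgebra D {k | k.1 = c.1}] B ∧
      tapeLaw D B ≤ ENNReal.ofReal (1 / 2) ^ numRuns n δ ∧
      ∀ ω ∉ B, runDepth X c ω (coreRun X δ ω c) ≤ (2 * m : ℕ) := by
  classical
  set Δ := idxDiam X c.2 with hΔ
  obtain ⟨i₀, hi₀⟩ : c.2.Nonempty := by
    rw [Finset.nonempty_iff_ne_empty]
    intro he
    rw [hΔ, he] at hc
    simp [idxDiam] at hc
  have hF : ∀ i ∈ c.2, ∀ j ∈ c.2, ‖X i - X j‖ ≤ Δ := fun i hi j hj => dist_le_idxDiam X hi hj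
  set r := Δ / 2 ^ J with hr
  have hr0 : 0 < r := by positivity
  have hdr : d * r ≤ Δ / 4096 := by
    rw [hr, mul_div_assoc', div_le_div_iff₀ (by positivity) (by norm_num)]
    nlinarith
  choose B hBm hBq hBs using fun p : Space D × Space D =>
    exists_separating_event h hM hd hX hc hF p.1 p.2 hr0 hdr
  set N : Finset (Space D × Space D) := h.net (X i₀) Δ J ×ˢ h.net (X i₀) Δ J with hN
  set O : Finset ℕ := (Finset.range (2 * m)).filter fun i => Odd (c.1.length + (i + 1)) with hO
  set R := numRuns n δ with hR
  refine ⟨{ω | ∀ j < R, ∃ p ∈ N, ∀ i ∈ O, ω (c.1, j, i) ∈ B p}, ?_, ?_, ?_⟩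
  · have e : {ω : Tape D | ∀ j < R, ∃ p ∈ N, ∀ i ∈ O, ω (c.1, j, i) ∈ B p} =
        ⋂ j ∈ Finset.range R, ⋃ p ∈ N, ⋂ i ∈ O, {ω | ω (c.1, j, i) ∈ B p} := by
      ext ω; simp
    rw [e]
    refine Finset.measurableSet_biInter _ fun j _ => Finset.measurableSet_biUnion _ fun p _ =>
      Finset.measurableSet_biInter _ fun i _ => ?_
    have hk : (c.1, j, i) ∈ {k : List Bool × ℕ × ℕ | k.1 = c.1} := by simp
    exact measurableSet_drawAlgebra hk (hBm p)
  · refine (tapeLaw_runs_le N hBm hBq c.1 O R).trans ?_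
    gcongr
    rw [card_odd_rounds]
    have hcard : (N.card : ENNReal) ≤ ENNReal.ofReal (((M : ℝ) ^ J) ^ 2) := by
      have h1 : N.card ≤ (M ^ J) ^ 2 := by
        rw [hN, Finset.card_product, sq]
        exact Nat.mul_le_mul (h.card_net_le _ _ _) (h.card_net_le _ _ _)
      rw [← ENNReal.ofReal_natCast]
      apply ENNReal.ofReal_le_ofReal
      exact_mod_cast h1
    calc _ ≤ ENNReal.ofReal (((M : ℝ) ^ J) ^ 2) * ENNReal.ofReal (575 / 576) ^ m := by gcongr
      _ = ENNReal.ofReal (((M : ℝ) ^ J) ^ 2 * (575 / 576) ^ m) := by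
        rw [← ENNReal.ofReal_pow (by norm_num), ← ENNReal.ofReal_mul (by positivity)]
      _ ≤ _ := ENNReal.ofReal_le_ofReal hm
  · intro ω hω
    simp only [Set.mem_ofPred_eq, not_forall, not_exists, not_and] at hω
    obtain ⟨j, hj, hω⟩ := hω
    refine (bestRun_le hj).trans (codeDepth_le (codeAvgDiam_le (by positivity) fun c' hc' => ?_))
    obtain ⟨hsub, hside⟩ := same_side_of_mem_codePartition hc'
    refine Metric.diam_le_of_forall_dist_le (by positivity) ?_
    rintro _ ⟨a, ha, rfl⟩ _ ⟨b, hb, rfl⟩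
    rw [dist_eq_norm]
    by_contra hfar
    obtain ⟨y, hy, hay⟩ := h.exists_mem_net hc (hX a) (hF a (hsub ha) i₀ hi₀) J
    obtain ⟨y', hy', hby'⟩ := h.exists_mem_net hc (hX b) (hF b (hsub hb) i₀ hi₀) J
    obtain ⟨i, hi, hωi⟩ := hω (y, y') (Finset.mem_product.2 ⟨hy, hy'⟩)
    obtain ⟨hi2, hiodd⟩ := Finset.mem_filter.1 hi
    exact hBs (y, y') _ hωi a (hsub ha) b (hsub hb) hay hby' (not_le.1 hfar)
      (hside a ha b hb i (Finset.mem_range.1 hi2) hiodd)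

/-! ### Counting the calls -/

lemma sum_map_flatMap {α β : Type*} {L : List α} {g : α → List β} {f : α → ℕ} {f' : β → ℕ}
    (h : ∀ a ∈ L, ((g a).map f').sum = f a) : ((L.flatMap g).map f').sum = (L.map f).sum := by
  induction L with
  | nil => rfl
  | cons a L ih =>
    rw [List.flatMap_cons, List.map_append, List.sum_append, List.map_cons, List.sum_cons,
      h a List.mem_cons_self, ih fun b hb => h b (List.mem_cons_of_mem _ hb)]

lemma sum_card_codePartition {D n : ℕ} (X : Fin n → Space D) (c₀ : Code n) (l : ℕ)
    (w : ℕ → Space D × ℝ) (i : ℕ) :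
    ((codePartition X c₀ l w i).map fun c => c.2.card).sum = c₀.2.card := by
  induction i with
  | zero => simp [codePartition]
  | succ i ih =>
    rw [codePartition, sum_map_flatMap (f := fun c => c.2.card) _, ih]
    intro c _
    simp only [codeSplit, List.map_cons, List.map_nil, List.sum_cons, List.sum_nil, add_zero]
    rw [add_comm]
    exact Finset.card_sdiff_add_card_eq_card (Finset.filter_subset _ _)

lemma addr_of_mem_codePartition {D n : ℕ} {X : Fin n → Space D} {c₀ : Code n} {l : ℕ}
    {w : ℕ → Space D × ℝ} {i : ℕ} {c : Code n} (hc : c ∈ codePartition X c₀ l w i) :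
    c₀.1 <:+ c.1 ∧ c.1.length = c₀.1.length + i := by
  induction i generalizing c with
  | zero =>
    rw [codePartition, List.mem_singleton] at hc
    subst hc
    exact ⟨List.suffix_rfl, rfl⟩
  | succ i ih =>
    rw [codePartition, List.mem_flatMap] at hc
    obtain ⟨c', hc', hcc'⟩ := hc
    obtain ⟨hsuf, hlen⟩ := ih hc'
    simp only [codeSplit, List.mem_cons, List.not_mem_nil, or_false] at hcc'
    rcases hcc' with rfl | rfl
    · exact ⟨hsuf.trans (List.suffix_cons _ _), by simp only [List.length_cons, hlen]; ring⟩
    · exact ⟨hsuf.trans (List.suffix_cons _ _), by simp only [List.length_cons, hlen]; ring⟩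

lemma exists_nonempty_idxDiam_le {D n : ℕ} {X : Fin n → Space D} {P : List (Code n)} {Δ : ℝ}
    (hΔ : 0 ≤ Δ) (hP : 0 < (P.map fun c => c.2.card).sum) (h : codeAvgDiam X P ≤ Δ) :
    ∃ c ∈ P, c.2.Nonempty ∧ idxDiam X c.2 ≤ Δ := by
  by_contra hcon
  push Not at hcon
  obtain ⟨c, hc, hcne⟩ : ∃ c ∈ P, c.2.Nonempty := by
    by_contra hne
    push Not at hne
    have : (P.map fun c => c.2.card).sum = 0 := by
      rw [List.sum_eq_zero_iff]
      intro x hx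
      obtain ⟨c, hc, rfl⟩ := List.mem_map.1 hx
      simp [hne c hc]
    omega
  have hn : (0 : ℝ) < n := by
    obtain ⟨i, -⟩ := hcne
    exact_mod_cast i.pos
  have hlt : (P.map fun c : Code n => Δ ^ 2 * ((c.2.card : ℝ) / n)).sum <
      (P.map fun c => (c.2.card : ℝ) / n * idxDiam X c.2 ^ 2).sum := by
    refine List.sum_lt_sum _ _ (fun b hb => ?_) ⟨c, hc, ?_⟩
    · rcases b.2.eq_empty_or_nonempty with he | hne
      · simp [he]
      · have := hcon b hb hne
        rw [mul_comm]
        gcongr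
    · have := hcon c hc hcne
      have hcard : (0 : ℝ) < c.2.card := by exact_mod_cast hcne.card_pos
      rw [mul_comm]
      gcongr
  have hpos : 0 < (P.map fun c : Code n => (c.2.card : ℝ) / n).sum := by
    have hge : (c.2.card : ℝ) / n ≤ (P.map fun c : Code n => (c.2.card : ℝ) / n).sum :=
      List.single_le_sum (fun x hx => by
        obtain ⟨b, -, rfl⟩ := List.mem_map.1 hx
        positivity) _ (List.mem_map.2 ⟨c, hc, rfl⟩)
    have hcard : (0 : ℝ) < c.2.card := by exact_mod_cast hcne.card_pos
    exact lt_of_lt_of_le (by positivity) hge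
  rw [List.sum_map_mul_left, ← lt_div_iff₀ hpos] at hlt
  rw [codeAvgDiam, Real.sqrt_le_left hΔ] at h
  linarith

/-- Whether a cell contains data. -/
def hasData {n : ℕ} (c : Code n) : Bool := decide c.2.Nonempty

lemma two_le_countP_hasData {n : ℕ} {P : List (Code n)} {c : Code n} (hc : c ∈ P)
    (hne : c.2.Nonempty) (hlt : c.2.card < (P.map fun c => c.2.card).sum) :
    2 ≤ P.countP hasData := by
  obtain ⟨P₁, P₂, rfl⟩ := List.append_of_mem hc
  have hex : ∃ b ∈ P₁ ++ P₂, hasData b := by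
    by_contra hcon
    push Not at hcon
    have hz : ((P₁ ++ P₂).map fun c => c.2.card).sum = 0 := by
      rw [List.sum_eq_zero_iff]
      intro x hx
      obtain ⟨b, hb, rfl⟩ := List.mem_map.1 hx
      simpa [hasData, Finset.not_nonempty_iff_eq_empty] using hcon b hb
    simp only [List.map_append, List.sum_append, List.map_cons, List.sum_cons] at hz hlt
    omega
  have h1 : 0 < (P₁ ++ P₂).countP hasData := List.countP_pos_iff.2 hex
  rw [List.countP_append] at h1 ⊢
  rw [List.countP_cons_of_pos (by simpa [hasData] using hne)]
  omega

lemma codeAvgDiam_singleton_of_idxDiam_eq_zero {D n : ℕ} {X : Fin n → Space D} {c : Code n}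
    (h : idxDiam X c.2 = 0) : codeAvgDiam X [c] = 0 := by
  simp [codeAvgDiam, h]

lemma runDepth_eq_zero {D n : ℕ} {X : Fin n → Space D} {c : Code n} (h : idxDiam X c.2 = 0)
    (ω : Tape D) (j : ℕ) : runDepth X c ω j = 0 := by
  refine le_antisymm (codeDepth_le (i := 0) ?_) zero_le
  rw [codePartition, codeAvgDiam_singleton_of_idxDiam_eq_zero h, h, zero_div]

lemma sum_card_codeLeaves {D n : ℕ} (X : Fin n → Space D) (δ : ℝ) (ω : Tape D) (c : Code n) :
    ((codeLeaves X δ ω c).map fun c => c.2.card).sum = c.2.card :=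
  sum_card_codePartition _ _ _ _ _

lemma suffix_of_mem_codeLeaves {D n : ℕ} {X : Fin n → Space D} {δ : ℝ} {ω : Tape D}
    {c c' : Code n} (h : c' ∈ codeLeaves X δ ω c) : c.1 <:+ c'.1 :=
  (addr_of_mem_codePartition h).1

lemma codeLeaves_eq_singleton {D n : ℕ} {X : Fin n → Space D} {δ : ℝ} {ω : Tape D} {c : Code n}
    (h : (runDepth X c ω (coreRun X δ ω c)).toNat = 0) : codeLeaves X δ ω c = [c] := by
  rw [codeLeaves, h, codePartition]

lemma eq_of_mem_codeLeaves {D n : ℕ} {X : Fin n → Space D} {δ : ℝ} {ω : Tape D}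
    {c c' : Code n} (h : c' ∈ codeLeaves X δ ω c) (hc : c'.1 = c.1) : c' = c := by
  have hlen := (addr_of_mem_codePartition h).2
  rw [hc] at hlen
  rw [codeLeaves_eq_singleton (by omega), List.mem_singleton] at h
  exact h

/-- A call that halts with a tree of positive depth distributes the data of its cell over at least
two leaves, because some leaf with data has a smaller diameter than the cell. -/
lemma two_le_countP_codeLeaves {D n : ℕ} {X : Fin n → Space D} {δ : ℝ} {ω : Tape D} {c : Code n}
    (hc : c.2.Nonempty) (h : codeLeaves X δ ω c ≠ [c]) :
    2 ≤ (codeLeaves X δ ω c).countP hasData := by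
  set j := coreRun X δ ω c with hj
  have hd : (runDepth X c ω j).toNat ≠ 0 := fun h0 => h (codeLeaves_eq_singleton h0)
  have hpos : 0 < idxDiam X c.2 := by
    refine lt_of_le_of_ne (idxDiam_nonneg X _) fun h0 => hd ?_
    rw [runDepth_eq_zero h0.symm]
    rfl
  have havg : codeAvgDiam X (codeLeaves X δ ω c) ≤ idxDiam X c.2 / 2 := by
    have hne : ((fun i : ℕ => (i : ℕ∞)) '' {i : ℕ | codeAvgDiam X (codePartition X c c.1.length
        (fun i => ω (c.1, j, i)) i) ≤ idxDiam X c.2 / 2}).Nonempty := by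
      by_contra hemp
      rw [Set.not_nonempty_iff_eq_empty] at hemp
      apply hd
      rw [runDepth, codeDepth, hemp, sInf_empty]
      rfl
    obtain ⟨m, hm, hm'⟩ := csInf_mem hne
    have hm2 : runDepth X c ω j = m := hm'.symm
    rw [codeLeaves, ← hj, hm2]
    exact hm
  have hsum := sum_card_codeLeaves X δ ω c
  obtain ⟨c', hc', hne', hle'⟩ := exists_nonempty_idxDiam_le (by positivity)
    (by rw [hsum]; exact hc.card_pos) havg
  refine two_le_countP_hasData hc' hne' ?_
  rw [hsum]
  refine Finset.card_lt_card (lt_of_le_of_ne (same_side_of_mem_codePartition hc').1 fun he => ?_)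
  rw [he] at hle'
  linarith

lemma sum_card_adaptiveCodes {D n : ℕ} (X : Fin n → Space D) (δ : ℝ) (ω : Tape D) (i : ℕ) :
    ((adaptiveCodes X δ ω i).map fun c => c.2.card).sum = n := by
  induction i with
  | zero => simp [adaptiveCodes]
  | succ i ih =>
    rw [adaptiveCodes, sum_map_flatMap (f := fun c => c.2.card) _, ih]
    exact fun c _ => sum_card_codeLeaves X δ ω c

lemma countP_hasData_le_sum_card {n : ℕ} (P : List (Code n)) :
    P.countP hasData ≤ (P.map fun c => c.2.card).sum := by
  induction P with
  | nil => simp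
  | cons c P ih =>
    rw [List.countP_cons, List.map_cons, List.sum_cons]
    split_ifs with h
    · have : 0 < c.2.card := Finset.card_pos.2 (by simpa [hasData] using h)
      omega
    · omega

/-- The potential argument behind the number of calls: each cell that is properly split (the set
`V`) adds a cell with data to the current partition. -/
lemma exists_split_codes {D n : ℕ} (hn : 0 < n) (X : Fin n → Space D) (δ : ℝ) (ω : Tape D)
    (i : ℕ) :
    ∃ V : Finset (Code n), V.card + 1 ≤ (adaptiveCodes X δ ω i).countP hasData ∧
      ∀ j ≤ i, ∀ c ∈ adaptiveCodes X δ ω j, c.2.Nonempty → c ∈ V ∨ c ∈ adaptiveCodes X δ ω i := by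
  classical
  induction i with
  | zero =>
    have : Nonempty (Fin n) := ⟨⟨0, hn⟩⟩
    refine ⟨∅, by simp [adaptiveCodes, hasData, Finset.univ_nonempty], fun j hj c hc _ => Or.inr ?_⟩
    rwa [Nat.le_zero.1 hj] at hc
  | succ i ih =>
    obtain ⟨V, hV, hVi⟩ := ih
    set P := adaptiveCodes X δ ω i with hP
    set Q := P.filter fun c => decide (c.2.Nonempty ∧ codeLeaves X δ ω c ≠ [c]) with hQ
    have hcount : P.countP hasData + Q.length ≤ (adaptiveCodes X δ ω (i + 1)).countP hasData := by
      rw [adaptiveCodes, ← hP, hQ]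
      clear_value P
      clear hVi hV hP hQ Q
      induction P with
      | nil => simp
      | cons c P ihP =>
        rw [List.flatMap_cons, List.countP_append, List.countP_cons, List.filter_cons]
        by_cases hc : c.2.Nonempty
        · have h3 : hasData c = true := by simpa [hasData] using hc
          by_cases hl : codeLeaves X δ ω c = [c]
          · have h1 : (codeLeaves X δ ω c).countP hasData = 1 := by
              rw [hl]; simp [h3]
            have h4 : ¬ (decide (c.2.Nonempty ∧ codeLeaves X δ ω c ≠ [c]) = true) := by simp [hl]
            rw [if_pos h3, if_neg h4]
            omega
          · have h2 := two_le_countP_codeLeaves hc hl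
            have h4 : decide (c.2.Nonempty ∧ codeLeaves X δ ω c ≠ [c]) = true := by
              simpa using ⟨hc, hl⟩
            rw [if_pos h3, if_pos h4, List.length_cons]
            omega
        · have h3 : ¬ (hasData c = true) := by simpa [hasData] using hc
          have h4 : ¬ (decide (c.2.Nonempty ∧ codeLeaves X δ ω c ≠ [c]) = true) := by
            simp [hc]
          rw [if_neg h3, if_neg h4]
          omega
    refine ⟨V ∪ Q.toFinset, ?_, fun j hj c hc hne => ?_⟩
    · have h1 := Finset.card_union_le V Q.toFinset
      have h2 := Q.toFinset_card_le
      omega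
    · rcases Nat.le_succ_iff.1 hj with hj | rfl
      · rcases hVi j hj c hc hne with hcV | hcP
        · exact Or.inl (Finset.mem_union_left _ hcV)
        · by_cases hl : codeLeaves X δ ω c = [c]
          · right
            rw [adaptiveCodes, List.mem_flatMap]
            exact ⟨c, hcP, by rw [hl]; exact List.mem_singleton_self c⟩
          · left
            refine Finset.mem_union_right _ (List.mem_toFinset.2 (List.mem_filter.2 ⟨hcP, ?_⟩))
            simpa using ⟨hne, hl⟩
      · exact Or.inr hc

lemma card_visited_le {D n : ℕ} (hn : 0 < n) (X : Fin n → Space D) (δ : ℝ) (ω : Tape D)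
    {s : Finset (Code n)} (hs : ∀ c ∈ s, c.2.Nonempty ∧ ∃ i, c ∈ adaptiveCodes X δ ω i) :
    s.card ≤ 2 * n := by
  classical
  choose! hne f hf using hs
  obtain ⟨V, hV, hVi⟩ := exists_split_codes hn X δ ω (s.sup f)
  have hsub : s ⊆ V ∪ ((adaptiveCodes X δ ω (s.sup f)).filter hasData).toFinset := by
    intro c hc
    rcases hVi (f c) (Finset.le_sup hc) c (hf c hc) (hne c hc) with h | h
    · exact Finset.mem_union_left _ h
    · refine Finset.mem_union_right _ (List.mem_toFinset.2 (List.mem_filter.2 ⟨h, ?_⟩))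
      simpa [hasData] using hne c hc
  have h1 := (Finset.card_le_card hsub).trans (Finset.card_union_le _ _)
  have h2 := ((adaptiveCodes X δ ω (s.sup f)).filter hasData).toFinset_card_le
  rw [← List.countP_eq_length_filter] at h2
  have h3 := countP_hasData_le_sum_card (adaptiveCodes X δ ω (s.sup f))
  rw [sum_card_adaptiveCodes] at h3
  omega

/-! ### Independence of the draws of a call from the past -/

/-- The event that `adaptiveRPtree`, run without a stopping criterion, reaches a node of code
`c`. -/
def reached {D n : ℕ} (X : Fin n → Space D) (δ : ℝ) (c : Code n) : Set (Tape D) :=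
  {ω | ∃ i, c ∈ adaptiveCodes X δ ω i}

lemma measurableSet_reached {D n : ℕ} (X : Fin n → Space D) (δ : ℝ) (c : Code n) :
    MeasurableSet (reached X δ c) := by
  have e : reached X δ c = ⋃ i, (fun ω => adaptiveCodes X δ ω i) ⁻¹' {P | c ∈ P} := by
    ext ω; simp [reached]
  rw [e]
  exact MeasurableSet.iUnion fun i => measurable_adaptiveCodes X δ i trivial

lemma codeLeaves_congr {D n : ℕ} (X : Fin n → Space D) (δ : ℝ) {ω ω' : Tape D} {c : Code n}
    (h : ∀ j i, ω (c.1, j, i) = ω' (c.1, j, i)) : codeLeaves X δ ω c = codeLeaves X δ ω' c := by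
  have hd : runDepth X c ω = runDepth X c ω' := by
    funext j
    simp only [runDepth, h]
  simp only [codeLeaves, coreRun, hd, h]

/-- Whether a node is reached is decided by draws at other nodes. -/
lemma reached_of_eq_off {D n : ℕ} {X : Fin n → Space D} {δ : ℝ} {ω ω' : Tape D} {c : Code n}
    (h : ∀ k : List Bool × ℕ × ℕ, k.1 ≠ c.1 → ω k = ω' k) (hω : ω ∈ reached X δ c) :
    ω' ∈ reached X δ c := by
  -- Nodes not below `c` occur at the same pass; `c` itself may be replaced at different passes.
  have key : ∀ i, ∀ b ∈ adaptiveCodes X δ ω i,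
      (¬ c.1 <:+ b.1 → b ∈ adaptiveCodes X δ ω' i) ∧
      (b.1 = c.1 → ∃ j, b ∈ adaptiveCodes X δ ω' j) := by
    intro i
    induction i with
    | zero => exact fun b hb => ⟨fun _ => hb, fun _ => ⟨0, hb⟩⟩
    | succ i ih =>
      intro b hb
      rw [adaptiveCodes, List.mem_flatMap] at hb
      obtain ⟨a, ha, hab⟩ := hb
      obtain ⟨ih1, ih2⟩ := ih a ha
      have hsuf := suffix_of_mem_codeLeaves hab
      have hstep : ¬ c.1 <:+ a.1 → b ∈ adaptiveCodes X δ ω' (i + 1) := by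
        intro hca
        rw [adaptiveCodes, List.mem_flatMap]
        refine ⟨a, ih1 hca, ?_⟩
        rwa [← codeLeaves_congr X δ fun j i => h (a.1, j, i) fun he => hca (by rw [← he])]
      refine ⟨fun hcb => hstep fun hca => hcb (hca.trans hsuf), fun hbc => ?_⟩
      by_cases hac : a.1 = c.1
      · rw [eq_of_mem_codeLeaves hab (hbc.trans hac.symm)]
        exact ih2 hac
      · refine ⟨i + 1, hstep fun hca => hac ?_⟩
        rw [hbc] at hsuf
        exact hsuf.eq_of_length (le_antisymm hsuf.length_le hca.length_le)
  obtain ⟨i, hi⟩ := hω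
  exact (key i c hi).2 rfl

lemma measurableSet_drawAlgebra_reached {D n : ℕ} (X : Fin n → Space D) (δ : ℝ) (c : Code n) :
    MeasurableSet[drawAlgebra D {k | k.1 ≠ c.1}] (reached X δ c) := by
  classical
  -- Erasing the draws at `c` does not affect the event.
  set T : Tape D → Tape D := fun ω k => if k.1 = c.1 then 0 else ω k with hT
  have e : reached X δ c = T ⁻¹' reached X δ c := by
    ext ω
    constructor
    · exact reached_of_eq_off fun k hk => by simp [hT, hk]
    · exact reached_of_eq_off fun k hk => by simp [hT, hk]
  have hTm : Measurable[drawAlgebra D {k | k.1 ≠ c.1}] T := by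
    refine @measurable_pi_lambda _ _ _ (drawAlgebra D {k | k.1 ≠ c.1}) _ T fun k => ?_
    by_cases hk : k.1 = c.1
    · simp only [hT, hk, if_true]
      exact @measurable_const _ _ _ (drawAlgebra D {k | k.1 ≠ c.1}) _
    · simp only [hT, hk, if_false]
      have hk' : k ∈ {k : List Bool × ℕ × ℕ | k.1 ≠ c.1} := hk
      exact fun B hB => measurableSet_drawAlgebra hk' hB
  rw [e]
  exact hTm (measurableSet_reached X δ c)

lemma tapeLaw_inter_eq_mul {D : ℕ} {K K' : Set (List Bool × ℕ × ℕ)} (hK : Disjoint K K')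
    {A B : Set (Tape D)} (hA : MeasurableSet[drawAlgebra D K] A)
    (hB : MeasurableSet[drawAlgebra D K'] B) :
    tapeLaw D (A ∩ B) = tapeLaw D A * tapeLaw D B := by
  have h : iIndepFun (fun (k : List Bool × ℕ × ℕ) (ω : Tape D) => ω k) (tapeLaw D) :=
    iIndepFun_infinitePi (P := fun _ => drawLaw D) (X := fun _ w => w) fun _ => measurable_id
  have hI := indep_iSup_of_disjoint (fun k => (measurable_pi_apply k).comap_le) h hK
  exact (Indep_iff _ _ _).1 hI A B hA hB

instance isProbabilityMeasure_tapeLaw (D : ℕ) : IsProbabilityMeasure (tapeLaw D) := by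
  unfold tapeLaw; infer_instance

lemma sum_tapeLaw_reached_le {D n : ℕ} (hn : 0 < n) (X : Fin n → Space D) (δ : ℝ)
    {s : Finset (Code n)} (hs : ∀ c ∈ s, c.2.Nonempty) :
    ∑ c ∈ s, tapeLaw D (reached X δ c) ≤ 2 * n := by
  classical
  calc ∑ c ∈ s, tapeLaw D (reached X δ c)
      = ∫⁻ ω, ∑ c ∈ s, (reached X δ c).indicator 1 ω ∂(tapeLaw D) := by
        rw [lintegral_finsetSum _ fun c _ =>
          measurable_one.indicator (measurableSet_reached X δ c)]
        simp only [lintegral_indicator_one (measurableSet_reached X δ _)]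
    _ ≤ ∫⁻ _, (2 * n : ENNReal) ∂(tapeLaw D) := by
        refine lintegral_mono fun ω => ?_
        have hcard : (s.filter fun c => ω ∈ reached X δ c).card ≤ 2 * n :=
          card_visited_le hn X δ ω fun c hc =>
            ⟨hs c (Finset.mem_filter.1 hc).1, (Finset.mem_filter.1 hc).2⟩
        have he : ∑ c ∈ s, (reached X δ c).indicator (1 : Tape D → ENNReal) ω =
            ((s.filter fun c => ω ∈ reached X δ c).card : ENNReal) := by
          simp only [Set.indicator_apply, Pi.one_apply]
          rw [Finset.sum_boole]
        simp only [he]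
        exact_mod_cast hcard
    _ = 2 * n := by simp

/-- Union bound over the calls that are made: if the failure of the call at `c` depends on the draws
at `c` only and has probability at most `p`, then some call fails with probability at most
`2 n p`, the expected number of calls being at most `2 n`. -/
lemma tapeLaw_iUnion_reached_inter_le {D n : ℕ} (hn : 0 < n) (X : Fin n → Space D) (δ : ℝ)
    {B : Code n → Set (Tape D)} {p : ENNReal}
    (hB : ∀ c, MeasurableSet[drawAlgebra D {k | k.1 = c.1}] (B c))
    (hp : ∀ c, tapeLaw D (B c) ≤ p) (hemp : ∀ c : Code n, ¬ c.2.Nonempty → B c = ∅) :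
    tapeLaw D (⋃ c, reached X δ c ∩ B c) ≤ 2 * n * p := by
  classical
  refine (measure_iUnion_le _).trans (ENNReal.summable.tsum_le_of_sum_le fun s => ?_)
  calc ∑ c ∈ s, tapeLaw D (reached X δ c ∩ B c)
      ≤ ∑ c ∈ s, (if c.2.Nonempty then tapeLaw D (reached X δ c) * p else 0) := by
        refine Finset.sum_le_sum fun c _ => ?_
        split_ifs with hc
        · have hdisj : Disjoint {k : List Bool × ℕ × ℕ | k.1 ≠ c.1} {k | k.1 = c.1} :=
            Set.disjoint_left.2 fun k h1 h2 => h1 h2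
          rw [tapeLaw_inter_eq_mul hdisj (measurableSet_drawAlgebra_reached X δ c) (hB c)]
          gcongr
          exact hp c
        · simp [hemp c hc]
    _ = (∑ c ∈ s.filter fun c => c.2.Nonempty, tapeLaw D (reached X δ c)) * p := by
        rw [← Finset.sum_filter, Finset.sum_mul]
    _ ≤ 2 * n * p := by
        gcongr
        exact sum_tapeLaw_reached_le hn X δ fun c hc => (Finset.mem_filter.1 hc).2

/-! ### Choice of the parameters -/

lemma half_pow_numRuns_le {n : ℕ} (hn : 0 < n) {δ : ℝ} (hδ : 0 < δ) :
    2 * n * ENNReal.ofReal (1 / 2) ^ numRuns n δ ≤ ENNReal.ofReal (δ / 3) := by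
  have hn1 : (1 : ℝ) ≤ n := by exact_mod_cast hn
  have h1 : 6 * (n : ℝ) ^ 2 / δ ≤ 2 ^ numRuns n δ := by
    have h := Nat.le_ceil (Real.logb 2 (6 * (n : ℝ) ^ 2 / δ))
    rw [Real.logb_le_iff_le_rpow (by norm_num) (by positivity), Real.rpow_natCast] at h
    exact h
  have h2 : 2 * n * ENNReal.ofReal (1 / 2) ^ numRuns n δ =
      ENNReal.ofReal (2 * n * (1 / 2) ^ numRuns n δ) := by
    rw [ENNReal.ofReal_mul (by positivity), ENNReal.ofReal_mul (by norm_num),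
      ENNReal.ofReal_pow (by norm_num), ENNReal.ofReal_natCast]
    norm_num
  rw [h2]
  apply ENNReal.ofReal_le_ofReal
  rw [div_le_iff₀ hδ] at h1
  rw [one_div, inv_pow, ← div_eq_mul_inv, div_le_div_iff₀ (by positivity) (by norm_num)]
  nlinarith

lemma half_le_logb {M : ℕ} {d : ℝ} (hM3 : 3 ≤ M) (hM : (M : ℝ) = (2 : ℝ) ^ d) :
    1 ≤ d ∧ 1 / 2 ≤ Real.logb 2 d := by
  have h3 : (3 : ℝ) ≤ (2 : ℝ) ^ d := by rw [← hM]; exact_mod_cast hM3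
  have hd : 3 / 2 ≤ d := by
    by_contra hcon
    have h1 : (2 : ℝ) ^ d ≤ (2 : ℝ) ^ (3 / 2 : ℝ) :=
      Real.rpow_le_rpow_of_exponent_le (by norm_num) (not_le.1 hcon).le
    have h2 : ((2 : ℝ) ^ (3 / 2 : ℝ)) ^ 2 = 8 := by
      rw [← Real.rpow_natCast, ← Real.rpow_mul (by norm_num)]
      norm_num
    nlinarith
  refine ⟨by linarith, ?_⟩
  rw [Real.le_logb_iff_rpow_le (by norm_num) (by linarith), ← Real.sqrt_eq_rpow]
  refine le_trans ?_ hd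
  rw [Real.sqrt_le_left (by norm_num)]
  norm_num

lemma pow_576_le_half : (575 / 576 : ℝ) ^ 576 ≤ 1 / 2 := by
  have h1 : (575 / 576 : ℝ) ≤ Real.exp (-(1 / 576)) := by
    have := Real.add_one_le_exp (-(1 / 576) : ℝ)
    linarith
  calc (575 / 576 : ℝ) ^ 576 ≤ Real.exp (-(1 / 576)) ^ 576 := by gcongr
    _ = (Real.exp 1)⁻¹ := by
      rw [← Real.exp_nat_mul, ← Real.exp_neg]
      norm_num
    _ ≤ (2 : ℝ)⁻¹ := by
      gcongr
      linarith [Real.exp_one_gt_d9]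
    _ = 1 / 2 := by norm_num

/-- Parameters for which `O(d log d)` rounds suffice: nets of radius `Δ / (4096 d)` consist of
`2 ^ O(d log d)` balls. -/
lemma exists_parameters {M : ℕ} {d : ℝ} (hM3 : 3 ≤ M) (hM : (M : ℝ) = (2 : ℝ) ^ d) :
    ∃ J m : ℕ, 4096 * d ≤ 2 ^ J ∧ ((M : ℝ) ^ J) ^ 2 * (575 / 576) ^ m ≤ 1 / 2 ∧
      (2 * m : ℕ) ≤ 70000 * d * Real.logb 2 d := by
  obtain ⟨hd, hlog⟩ := half_le_logb hM3 hM
  set L := Real.logb 2 d with hL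
  set J := ⌈Real.logb 2 (4096 * d)⌉₊ with hJ
  set t := ⌈2 * d * J + 1⌉₊ with ht
  have hlogJ : Real.logb 2 (4096 * d) = 12 + L := by
    rw [Real.logb_mul (by norm_num) (by linarith), ← hL]
    congr 1
    rw [show (4096 : ℝ) = 2 ^ (12 : ℝ) by norm_num, Real.logb_rpow (by norm_num) (by norm_num)]
  have hJle : (J : ℝ) ≤ 13 + L := by
    have := Nat.ceil_lt_add_one (show 0 ≤ Real.logb 2 (4096 * d) by rw [hlogJ]; linarith)
    rw [← hJ] at this
    linarith
  have htle : (t : ℝ) ≤ 2 * d * J + 2 := by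
    have := Nat.ceil_lt_add_one (show 0 ≤ 2 * d * (J : ℝ) + 1 by positivity)
    rw [← ht] at this
    linarith
  refine ⟨J, 576 * t, ?_, ?_, ?_⟩
  · have h := Nat.le_ceil (Real.logb 2 (4096 * d))
    rw [Real.logb_le_iff_le_rpow (by norm_num) (by positivity), Real.rpow_natCast] at h
    exact h
  · have h1 : ((M : ℝ) ^ J) ^ 2 = (2 : ℝ) ^ (2 * d * J) := by
      rw [hM, ← Real.rpow_natCast, ← Real.rpow_natCast, ← Real.rpow_mul (by positivity),
        ← Real.rpow_mul (by positivity)]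
      congr 1
      push_cast
      ring
    have h2 : (2 : ℝ) ^ (2 * d * J) * 2 ≤ 2 ^ t := by
      have h := Nat.le_ceil (2 * d * (J : ℝ) + 1)
      calc (2 : ℝ) ^ (2 * d * J) * 2 = (2 : ℝ) ^ (2 * d * (J : ℝ) + 1) := by
            rw [Real.rpow_add (by norm_num), Real.rpow_one]
        _ ≤ (2 : ℝ) ^ (t : ℝ) := Real.rpow_le_rpow_of_exponent_le (by norm_num) h
        _ = 2 ^ t := Real.rpow_natCast _ _
    have h3 : (575 / 576 : ℝ) ^ (576 * t) ≤ (1 / 2) ^ t := by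
      rw [pow_mul]
      exact pow_le_pow_left₀ (by positivity) pow_576_le_half t
    rw [h1]
    calc _ ≤ (2 : ℝ) ^ (2 * d * J) * (1 / 2) ^ t := by gcongr
      _ ≤ 1 / 2 := by
        rw [one_div, inv_pow, ← div_eq_mul_inv, div_le_iff₀ (by positivity)]
        linarith
  · push_cast
    have h1 : d * J ≤ d * (13 + L) := by gcongr
    have h2 : d * (1 / 2) ≤ d * L := by gcongr
    linarith

end RPTree

end

open RPTree in
theorem mainTheorem3 :
    ∃ C' : ℝ, 0 < C' ∧
      ∀ (D : ℕ) (S : Set (RPTree.Space D)) (d : ℝ), RPTree.IsAssouadDim S d → 1 < d →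
      ∀ (n : ℕ), 0 < n → ∀ (X : Fin n → RPTree.Space D), (∀ i, X i ∈ S) →
      ∀ (δ : ℝ), 0 < δ → δ < 1 → ∀ (opt : RPTree.StopOption),
        ∃ G : Set (RPTree.Tape D), MeasurableSet G ∧
          ENNReal.ofReal (1 - δ / 3) ≤ RPTree.tapeLaw D G ∧
          ∀ ω ∈ G, ∃ k : ℝ, k ≤ C' * d * Real.logb 2 d ∧
            RPTree.AttainsRate opt X S δ d ω k := by
  refine ⟨70000, by norm_num, fun D S d hSd hd1 n hn X hX δ hδ _ opt => ?_⟩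
  classical
  obtain ⟨M, hM3, hM, h⟩ := hSd.exists_hasDoublingConst hd1
  obtain ⟨hd, hlog⟩ := half_le_logb hM3 hM
  obtain ⟨J, m, hJ, hm, hmk⟩ := exists_parameters hM3 hM
  have hcall : ∀ c : Code n, ∃ B : Set (Tape D),
      MeasurableSet[drawAlgebra D {k | k.1 = c.1}] B ∧
      tapeLaw D B ≤ ENNReal.ofReal (1 / 2) ^ numRuns n δ ∧ (¬ c.2.Nonempty → B = ∅) ∧
      ∀ ω ∉ B, runDepth X c ω (coreRun X δ ω c) ≤ (2 * m : ℕ) := by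
    intro c
    rcases (idxDiam_nonneg X c.2).lt_or_eq with hc | hc
    · obtain ⟨B, hB1, hB2, hB3⟩ := exists_call_event h hM hd hX hJ hm δ hc
      refine ⟨B, hB1, hB2, fun he => ?_, hB3⟩
      rw [Finset.not_nonempty_iff_eq_empty.1 he] at hc
      simp [idxDiam] at hc
    · refine ⟨∅, @MeasurableSet.empty _ (drawAlgebra D {k | k.1 = c.1}), by simp, fun _ => rfl,
        fun ω _ => ?_⟩
      rw [runDepth_eq_zero hc.symm]
      exact zero_le
  choose B hBm hBp hBe hBd using hcall
  set bad : Set (Tape D) := ⋃ c, reached X δ c ∩ B c with hbad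
  have hbadm : MeasurableSet bad :=
    MeasurableSet.iUnion fun c => (measurableSet_reached X δ c).inter (drawAlgebra_le D _ _ (hBm c))
  have hbadle : tapeLaw D bad ≤ ENNReal.ofReal (δ / 3) :=
    (tapeLaw_iUnion_reached_inter_le hn X δ hBm hBp hBe).trans (half_pow_numRuns_le hn hδ)
  refine ⟨badᶜ, hbadm.compl, ?_, fun ω hω => ⟨70000 * d * Real.logb 2 d, le_rfl, ?_, ?_⟩⟩
  · rw [prob_compl_eq_one_sub hbadm, ENNReal.ofReal_sub _ (by positivity), ENNReal.ofReal_one]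
    gcongr
  · nlinarith
  · intro i _ N hN
    have hreach : ω ∈ reached X δ (N.code X) :=
      ⟨i, by rw [← map_code_adaptivePartition hX]; exact List.mem_map_of_mem hN⟩
    have hgood : ω ∉ B (N.code X) := fun hmem => hω (Set.mem_iUnion.2 ⟨_, hreach, hmem⟩)
    have hdepth := hBd _ ω hgood
    rw [← coreCall_depth] at hdepth
    obtain ⟨k, hk⟩ := ENat.ne_top_iff_exists.1 (ne_top_of_le_ne_top (ENat.natCast_ne_top _) hdepth)
    refine ⟨k, hk.symm, ?_⟩
    rw [← hk] at hdepth
    have : k ≤ 2 * m := by exact_mod_cast hdepth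
    exact le_trans (by exact_mod_cast this) hmk
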